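/- \textbf{Model.} A base station serves a finite set $\mathcal R$ of real-time (RT) users and a finite non-empty set $\mathcal N$ of non-real-time (NRT) users in slots $k=0,1,2,\dots$ of duration $T>0$; a packet has $L>0$ bits. At the beginning of slot $k$ it observes arrival indicators $a_i(k)\in\{0,1\}$ and on-off channel states $\gamma_i(k)\in\{0,1\}$, $i\in\mathcal R\cup\mathcal N$. The vectors $(a(k),\gamma(k))$ are independent and identically distributed over $k$ (no assumption is made on their law within a slot); $\lambda_i=\Pr(a_i(k)=1)$. A slot-based algorithm chooses in slot $k$, from the information available then (present and past observations, possibly extra randomization; information up to slot $k$ is independent of the observation of slot $k+1$), durations $\mu_i(k)$, powers $P_i(k)$ and, for $i\in\mathcal N$, admissions $r_i(k)\in\{0,1\}$. Put $R_i(k)=\log(1+P_i(k)\gamma_i(k))$. The NRT queues, started at given $Q_i(0)\ge0$, obey $Q_i(k+1)=(Q_i(k)+Lr_i(k)-\mu_i(k)R_i(k))^+$. The number of packets delivered in slot $k$ is $D_i(k)=\mu_i(k)R_i(k)/L$ for $i\in\mathcal R$ and $D_i(k)=\min\{\mu_i(k)R_i(k),\,Q_i(k)+Lr_i(k)\}/L$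 for $i\in\mathcal N$. \textbf{Problem.} Given $P_{\max},P_{\rm avg}\ge0$ and $q_i\in[0,1]$ ($i\in\mathcal R$), maximize the NRT sum throughput $$\liminf_{K\to\infty}\frac1K\sum_{k<K}\sum_{i\in\mathcal N}\mathbb E[D_i(k)]$$ over slot-based algorithms subject to: $r_i(k)\le a_i(k)$ and $\limsup_{k}\mathbb E[Q_i(k)]<\infty$ for $i\in\mathcal N$; $\liminf_K\frac1K\sum_{k<K}\mathbb E[D_i(k)]\ge\lambda_iq_i$ for $i\in\mathcal R$; $\limsup_K\frac1K\sum_{k<K}\mathbb E[\frac1T\sum_iP_i(k)\mu_i(k)]\le P_{\rm avg}$; $0\le P_i(k)\le P_{\max}$, $0\le\mu_i(k)\le T$, $\sum_i\mu_i(k)=T$; and, for $i\in\mathcal R$, $\mu_i(k)\neq0$ only if $a_i(k)=1$ and $\mu_i(k)R_i(k)=L$. Let $\theta^*$ be the supremum of the sum throughput over the algorithms that satisfy these constraints. \textbf{Algorithm 1 (parameter $B>0$).} Besides $Q$ it keeps virtual queues, with arbitrary initial values $\ge0$, $Y_i(k+1)=(Y_i(k)+a_i(k)q_i-\mathbf 1[\mu_i(k)\ne0])^+$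 for $i\in\mathcal R$ and $X(k+1)=(X(k)+\frac1T\sum_iP_i(k)\mu_i(k)-P_{\rm avg})^+$. In each slot (index $k$ omitted; ties broken arbitrarily): (1) let $i^*$ be an NRT user with longest queue among those with $\gamma_i=1$, let $P_{i^*}=\min\{(TQ_{i^*}/X-1)^+,P_{\max}\}$ and $\Psi=Q_{i^*}\log(1+P_{i^*})-XP_{i^*}/T$; if no NRT user has $\gamma_i=1$, let $i^*\in\mathcal N$ be arbitrary, $P_{i^*}=0$, $\Psi=0$. (2) For $n\ge1$ let $z=T\Psi/X-1$ and $p=\min\{z/W_0(z/e)-1,P_{\max}\}$, where $W_0$ is the principal branch of the Lambert function; let $p_n=p$ if $p>0$ and $nL/\log(1+p)\le T$, and $p_n=e^{nL/T}-1$ otherwise; let $m_n=L/\log(1+p_n)$. The expressions in (1) and (2) are read as their limits $X\downarrow0$ if $X=0$ and $z\to0$ if $z=0$. (3) A candidate set is a (possibly empty) set $S$ of RT users with $a_i=\gamma_i=1$ such that $Y_i\ge Y_j$ for all $i\in S$ and all $j\notin S$ with $a_j=\gamma_j=1$, and $p_{|S|}\le P_{\max}$ if $S\neq\emptyset$. Choose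 a candidate set $S$ maximizing $\sum_{i\in S}\big(Y_i-Xp_{|S|}m_{|S|}/T\big)+\Psi\,(T-|S|m_{|S|})$, with $|S|m_{|S|}=0$ for $S=\emptyset$. (4) Set $P_i=p_{|S|}$, $\mu_i=m_{|S|}$ for $i\in S$; $\mu_{i^*}=T-|S|m_{|S|}$; all other durations and powers are $0$; for $i\in\mathcal N$ set $r_i=a_i$ if $Q_i<B$ and $r_i=0$ otherwise. \textbf{Theorem.} Suppose that some slot-based algorithm satisfies all constraints of the problem. Then for every $B>0$ Algorithm 1 can be run as a slot-based algorithm, and every run of it (whatever the tie-breaking) satisfies all constraints of the problem; moreover the delivery-ratio constraint and the average-power constraint also hold almost surely without the expectations. Its NRT sum throughput is at least $$\theta^*-\frac{C_1}{LB},\qquad C_1=\frac12\Big(\sum_{i\in\mathcal R}(q_i^2+1)+P_{\max}^2+P_{\rm avg}^2+|\mathcal N|\big(L^2+T^2\log^2(1+P_{\max})\big)\Big).$$ -/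

import Mathlib

open MeasureTheory ProbabilityTheory Filter

noncomputable section

namespace RTNRT

/-- The constants of the downlink system with real-time (RT) users `R` and non-real-time (NRT)
users: packet length `L`, slot duration `T`, maximal power, average power budget, and the
required delivery ratios `q` of the RT users. -/
structure Params (R : Type*) where
  L : ℝ
  T : ℝ
  Pmax : ℝ
  Pavg : ℝ
  q : R → ℝ
  L_pos : 0 < L
  T_pos : 0 < T
  Pmax_nonneg : 0 ≤ Pmax
  Pavg_nonneg : 0 ≤ Pavg
  q_nonneg : ∀ i, 0 ≤ q i
  q_le_one : ∀ i, q i ≤ 1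

/-- What the base station observes at the beginning of a slot: the packet arrival indicators
`a_i` (first component) and the on-off channel states `γ_i` (second component). -/
abbrev Slot (R N : Type*) := (R ⊕ N → Bool) × (R ⊕ N → Bool)

/-- The decisions of one slot: durations `μ_i`, powers `P_i`, and admissions `r_i`. -/
structure Action (R N : Type*) where
  dur : R ⊕ N → ℝ
  pow : R ⊕ N → ℝ
  adm : N → Bool

/-- The queues: virtual delivery queues `Y_i`, data queues `Q_i`, virtual power queue `X`. -/
structure State (R N : Type*) where
  Y : R → ℝ
  Q : N → ℝ
  X : ℝ

def State.Nonneg {R N : Type*} (u : State R N) : Prop :=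
  (∀ i, 0 ≤ u.Y i) ∧ (∀ i, 0 ≤ u.Q i) ∧ 0 ≤ u.X

/-- `{true, false}` read as `{1, 0}`. -/
def ind (b : Bool) : ℝ := if b then 1 else 0

section Model

variable {R N : Type*} [Fintype R] [Fintype N]

/-- Transmission rate `R_i = log (1 + P_i γ_i)`. -/
def rate (s : Slot R N) (d : Action R N) (j : R ⊕ N) : ℝ :=
  Real.log (1 + d.pow j * ind (s.2 j))

/-- Power spent in a slot, averaged over the slot: `(∑ i, P_i μ_i) / T`. -/
def slotPower (p : Params R) (d : Action R N) : ℝ :=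
  (∑ j, d.pow j * d.dur j) / p.T

/-- Bits delivered to a user in a slot. For an RT user this is `μ_i R_i` (`L` if it is scheduled,
`0` otherwise); for an NRT user it is `μ_i R_i`, limited by the data present in the buffer. -/
def bits (p : Params R) (u : State R N) (s : Slot R N) (d : Action R N) : R ⊕ N → ℝ
  | Sum.inl i => d.dur (Sum.inl i) * rate s d (Sum.inl i)
  | Sum.inr i => min (d.dur (Sum.inr i) * rate s d (Sum.inr i)) (u.Q i + p.L * ind (d.adm i))

open Classical in
/-- One-slot evolution of the data queues and of the virtual queues. -/
def step (p : Params R) (u : State R N) (s : Slot R N) (d : Action R N) : State R N where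
  Y i := max (u.Y i + ind (s.1 (Sum.inl i)) * p.q i
    - (if d.dur (Sum.inl i) ≠ 0 then 1 else 0)) 0
  Q i := max (u.Q i + p.L * ind (d.adm i)
    - d.dur (Sum.inr i) * rate s d (Sum.inr i)) 0
  X := max (u.X + slotPower p d - p.Pavg) 0

/-- The per-slot constraints. A scheduled RT user (`μ_i ≠ 0`) must have received a packet in this
slot, and it is served for exactly the time `μ_i = L / R_i` that its packet needs. -/
structure Action.Valid (p : Params R) (s : Slot R N) (d : Action R N) : Prop where
  adm_le : ∀ i : N, d.adm i = true → s.1 (Sum.inr i) = true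
  pow_mem : ∀ j, d.pow j ∈ Set.Icc 0 p.Pmax
  dur_mem : ∀ j, d.dur j ∈ Set.Icc 0 p.T
  sum_dur : ∑ j, d.dur j = p.T
  rt : ∀ i : R, d.dur (Sum.inl i) ≠ 0 →
    s.1 (Sum.inl i) = true ∧ d.dur (Sum.inl i) * rate s d (Sum.inl i) = p.L

variable {Ω : Type*}

/-- The queues at the beginning of each slot, starting at `u₀`, when the decisions `π` are used. -/
def queues (p : Params R) (u₀ : State R N) (obs : ℕ → Ω → Slot R N) (π : ℕ → Ω → Action R N) :
    ℕ → Ω → State R N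
  | 0, _ => u₀
  | k + 1, ω => step p (queues p u₀ obs π k ω) (obs k ω) (π k ω)

/-- Packets delivered to user `j` in slot `k`. -/
def packets (p : Params R) (u₀ : State R N) (obs : ℕ → Ω → Slot R N) (π : ℕ → Ω → Action R N)
    (j : R ⊕ N) (k : ℕ) (ω : Ω) : ℝ :=
  bits p (queues p u₀ obs π k ω) (obs k ω) (π k ω) j / p.L

/-- Average of the first `K` terms of a sequence. -/
def timeAvg (f : ℕ → ℝ) (K : ℕ) : ℝ := (∑ k ∈ Finset.range K, f k) / K

/-- The on-off model: arrivals and channel states are known at the beginning of their slot, they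
are independent and identically distributed over the slots, and RT user `i` receives a packet
with probability `lam i`. The `σ`-algebra `ℱ k` is the information that is available for the
decisions in slot `k`; it may include additional randomization. -/
structure IsOnOffModel [mΩ : MeasurableSpace Ω] (μ : Measure Ω) (ℱ : Filtration ℕ mΩ)
    (obs : ℕ → Ω → Slot R N) (lam : R → ℝ) : Prop where
  measurable : ∀ k, Measurable[ℱ k] (obs k)
  indep : ∀ k, Indep (MeasurableSpace.comap (obs (k + 1)) inferInstance) (ℱ k) μ
  identDistrib : ∀ k, IdentDistrib (obs k) (obs 0) μ μ
  arrival : ∀ i, μ.real {ω | (obs 0 ω).1 (Sum.inl i) = true} = lam i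

/-- A slot-based algorithm: the decisions of slot `k` are taken with the information `ℱ k`. -/
structure IsPolicy [mΩ : MeasurableSpace Ω] (ℱ : Filtration ℕ mΩ)
    (π : ℕ → Ω → Action R N) : Prop where
  dur : ∀ k j, Measurable[ℱ k] fun ω => (π k ω).dur j
  pow : ∀ k j, Measurable[ℱ k] fun ω => (π k ω).pow j
  adm : ∀ k i, Measurable[ℱ k] fun ω => (π k ω).adm i

/-- Slot-based algorithms that satisfy all constraints of the throughput problem. -/
structure IsFeasible [mΩ : MeasurableSpace Ω] (μ : Measure Ω) (ℱ : Filtration ℕ mΩ)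
    (p : Params R) (lam : R → ℝ) (u₀ : State R N) (obs : ℕ → Ω → Slot R N)
    (π : ℕ → Ω → Action R N) : Prop where
  policy : IsPolicy ℱ π
  valid : ∀ k ω, (π k ω).Valid p (obs k ω)
  stable : ∀ i : N,
    limsup (fun k => ((∫ ω, (queues p u₀ obs π k ω).Q i ∂μ : ℝ) : EReal)) atTop < ⊤
  delivery : ∀ i : R, lam i * p.q i ≤
    liminf (timeAvg fun k => ∫ ω, packets p u₀ obs π (Sum.inl i) k ω ∂μ) atTop
  power : limsup (timeAvg fun k => ∫ ω, slotPower p (π k ω) ∂μ) atTop ≤ p.Pavg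

/-- The NRT sum throughput in packets per slot. -/
def sumThroughput [MeasurableSpace Ω] (μ : Measure Ω) (p : Params R) (u₀ : State R N)
    (obs : ℕ → Ω → Slot R N) (π : ℕ → Ω → Action R N) : ℝ :=
  liminf (timeAvg fun k => ∑ i : N, ∫ ω, packets p u₀ obs π (Sum.inr i) k ω ∂μ) atTop

/-- The optimal NRT sum throughput. -/
def optThroughput [mΩ : MeasurableSpace Ω] (μ : Measure Ω) (ℱ : Filtration ℕ mΩ)
    (p : Params R) (lam : R → ℝ) (u₀ : State R N) (obs : ℕ → Ω → Slot R N) : ℝ :=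
  sSup (sumThroughput μ p u₀ obs '' {π | IsFeasible μ ℱ p lam u₀ obs π})

/-- The constant `C₁`, with `Rmax = log (1 + Pmax)`. -/
def C1 (p : Params R) (N : Type*) [Fintype N] : ℝ :=
  (∑ i, (p.q i ^ 2 + 1) + p.Pmax ^ 2 + p.Pavg ^ 2
    + Fintype.card N * (p.L ^ 2 + p.T ^ 2 * Real.log (1 + p.Pmax) ^ 2)) / 2

end Model

section Algorithm

/-- Principal branch of the Lambert `W` function: the inverse of `w ↦ w * exp w` on `[-1, ∞)`. -/
def lambertW0 (z : ℝ) : ℝ := Function.invFunOn (fun w => w * Real.exp w) (Set.Ici (-1)) z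

variable {R N : Type*}

/-- Water-filling power `min ((T Q_i / X - 1)⁺, Pmax)` of an NRT user with channel on, read as its
limit from the right at `X = 0`. A user with channel off transmits nothing. -/
def nrtPower (p : Params R) (u : State R N) (s : Slot R N) (i : N) : ℝ :=
  if s.2 (Sum.inr i) = false then 0
  else if u.X = 0 then (if u.Q i = 0 then 0 else p.Pmax)
  else min (max (p.T * u.Q i / u.X - 1) 0) p.Pmax

/-- `Ψ_NR(i) = Q_i R_i - X P_i / T` at the water-filling power. -/
def psiNR (p : Params R) (u : State R N) (s : Slot R N) (i : N) : ℝ :=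
  u.Q i * Real.log (1 + nrtPower p u s i * ind (s.2 (Sum.inr i))) - u.X * nrtPower p u s i / p.T

/-- `i` has the longest queue among the NRT users with channel on. If there is no such user, `i` is
arbitrary (its power is `0`, so the time that it is given is idle time). -/
def IsLongest (u : State R N) (s : Slot R N) (i : N) : Prop :=
  (s.2 (Sum.inr i) = true ∧ ∀ j, s.2 (Sum.inr j) = true → u.Q j ≤ u.Q i) ∨
    ∀ j : N, s.2 (Sum.inr j) = false

/-- Lambert power `min (z / W₀(z / e) - 1, Pmax)` with `z = T ψ / X - 1`, read as its limit at
`z = 0`, and as its limit from the right at `X = 0`. -/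
def lambertPower (p : Params R) (X ψ : ℝ) : ℝ :=
  if X = 0 then (if ψ = 0 then 0 else p.Pmax)
  else
    let z := p.T * ψ / X - 1
    min ((if z = 0 then Real.exp 1 else z / lambertW0 (z / Real.exp 1)) - 1) p.Pmax

open Classical in
/-- Power of each of `n` scheduled RT users: the Lambert power if the `n` packets then fit into the
slot (zero power needs infinite time and never fits), otherwise the power at which they fill the
slot exactly. -/
def rtPower (p : Params R) (X ψ : ℝ) (n : ℕ) : ℝ :=
  if 0 < lambertPower p X ψ ∧ n * (p.L / Real.log (1 + lambertPower p X ψ)) ≤ p.T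
  then lambertPower p X ψ
  else Real.exp (n * p.L / p.T) - 1

/-- Duration `L / R_i` of the transmission to each of `n` scheduled RT users. -/
def rtDur (p : Params R) (X ψ : ℝ) (n : ℕ) : ℝ :=
  p.L / Real.log (1 + rtPower p X ψ n)

/-- Candidate sets of RT users: all members have a packet and channel on, no other such user has a
larger `Y`, and the power that the set needs does not exceed the maximal power. -/
structure IsCandidate (p : Params R) (u : State R N) (s : Slot R N) (ψ : ℝ)
    (S : Finset R) : Prop where
  eligible : ∀ i ∈ S, s.1 (Sum.inl i) = true ∧ s.2 (Sum.inl i) = true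
  largest : ∀ i ∈ S, ∀ j ∉ S, s.1 (Sum.inl j) = true → s.2 (Sum.inl j) = true → u.Y j ≤ u.Y i
  pow_le : rtPower p u.X ψ S.card ≤ p.Pmax

/-- The value of a candidate set: `∑_{i ∈ S} (Y_i - X P_i μ_i / T)` plus `ψ` times the time that is
left for the NRT user. -/
def psiAux (p : Params R) (u : State R N) (ψ : ℝ) (S : Finset R) : ℝ :=
  ∑ i ∈ S, (u.Y i - u.X * rtPower p u.X ψ S.card * rtDur p u.X ψ S.card / p.T)
    + ψ * (p.T - S.card * rtDur p u.X ψ S.card)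

open Classical in
/-- `d` is a decision of the scheduling and power allocation algorithm with control parameter `B`
for queues `u` and observation `s`. Ties may be broken in any way. -/
def IsAlgDecision (p : Params R) (B : ℝ) (u : State R N) (s : Slot R N) (d : Action R N) : Prop :=
  ∃ (i₀ : N) (S : Finset R),
    IsLongest u s i₀ ∧
    IsCandidate p u s (psiNR p u s i₀) S ∧
    (∀ S', IsCandidate p u s (psiNR p u s i₀) S' →
      psiAux p u (psiNR p u s i₀) S' ≤ psiAux p u (psiNR p u s i₀) S) ∧
    (∀ i : R, d.pow (Sum.inl i) = if i ∈ S then rtPower p u.X (psiNR p u s i₀) S.card else 0) ∧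
    (∀ i : R, d.dur (Sum.inl i) = if i ∈ S then rtDur p u.X (psiNR p u s i₀) S.card else 0) ∧
    (∀ i : N, d.pow (Sum.inr i) = if i = i₀ then nrtPower p u s i₀ else 0) ∧
    (∀ i : N, d.dur (Sum.inr i) =
      if i = i₀ then p.T - S.card * rtDur p u.X (psiNR p u s i₀) S.card else 0) ∧
    (∀ i : N, d.adm i = if u.Q i < B then s.1 (Sum.inr i) else false)

/-- `π` is an execution of the algorithm with control parameter `B`. -/
structure IsAlgorithm [Fintype R] [Fintype N] {Ω : Type*} [mΩ : MeasurableSpace Ω]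
    (ℱ : Filtration ℕ mΩ) (p : Params R) (B : ℝ) (u₀ : State R N) (obs : ℕ → Ω → Slot R N)
    (π : ℕ → Ω → Action R N) : Prop where
  policy : IsPolicy ℱ π
  decision : ∀ k ω, IsAlgDecision p B (queues p u₀ obs π k ω) (obs k ω) (π k ω)

end Algorithm

end RTNRT

end

/-!
The algorithm maximizes, over all valid decisions of a slot, the sum of the queues weighted by
their service surplus plus the reward `B L` per admitted packet. This is concave power allocation:
for a fixed set of scheduled RT users the Lambert power solves the first-order condition, and an
exchange argument shows that the scheduled users may be taken with the largest `Y`.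

A feasible competitor uses the same observations but knows nothing about the queues of the
algorithm. Since the observations are i.i.d., its decisions in slot `j` can be compared with those
of the algorithm in slot `k`, given the observation and independently of the queues in slot `k`.
Averaging over `j` turns the long-term constraints of the competitor into a drift bound for
the algorithm, without passing through stationary randomized policies.

The drift bound makes the second moments of the queues grow at most linearly, so all queues are
rate stable, in mean and almost surely along the squares and hence along all slots; this gives the
time-average constraints. Summing the drift bound compares the admission rates, and the data
queues are bounded by admission control, so admissions and deliveries have the same rate.
-/

namespace RTNRT

open scoped Topology

section LambertW

lemma strictMonoOn_mul_exp : StrictMonoOn (fun w : ℝ => w * Real.exp w) (Set.Ici (-1)) := by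
  refine strictMonoOn_of_deriv_pos (convex_Ici _) (by fun_prop) fun x hx => ?_
  rw [interior_Ici, Set.mem_Ioi] at hx
  have hderiv : HasDerivAt (fun w : ℝ => w * Real.exp w) (1 * Real.exp x + x * Real.exp x) x :=
    (hasDerivAt_id x).mul (Real.hasDerivAt_exp x)
  rw [hderiv.deriv, ← add_mul]
  exact mul_pos (by linarith) (Real.exp_pos x)

lemma exists_mul_exp_eq {z : ℝ} (hz : -Real.exp (-1) ≤ z) :
    ∃ w ∈ Set.Ici (-1 : ℝ), w * Real.exp w = z := by
  have hle : z ≤ |z| * Real.exp |z| := (le_abs_self z).trans <|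
    le_mul_of_one_le_right (abs_nonneg z) (Real.one_le_exp (abs_nonneg z))
  obtain ⟨w, hw, hwz⟩ := intermediate_value_Icc (by linarith [abs_nonneg z])
    (Continuous.continuousOn (f := fun w : ℝ => w * Real.exp w) (s := Set.Icc (-1) |z|)
      (by fun_prop)) ⟨by linarith, hle⟩
  exact ⟨w, hw.1, hwz⟩

lemma neg_one_le_lambertW0 {z : ℝ} (hz : -Real.exp (-1) ≤ z) : -1 ≤ lambertW0 z :=
  Function.invFunOn_mem (exists_mul_exp_eq hz)

lemma lambertW0_mul_exp {z : ℝ} (hz : -Real.exp (-1) ≤ z) :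
    lambertW0 z * Real.exp (lambertW0 z) = z :=
  Function.invFunOn_eq (exists_mul_exp_eq hz)

lemma monotoneOn_lambertW0 : MonotoneOn lambertW0 (Set.Ici (-Real.exp (-1))) := by
  intro a ha b hb hab
  rw [← strictMonoOn_mul_exp.le_iff_le (neg_one_le_lambertW0 ha) (neg_one_le_lambertW0 hb)]
  simpa only [lambertW0_mul_exp ha, lambertW0_mul_exp hb] using hab

lemma measurable_lambertW0 : Measurable lambertW0 := by
  -- Below `-1 / e` there is no solution and `Function.invFunOn` returns one fixed default value.
  have hconst : ∀ z < -Real.exp (-1), lambertW0 z = Classical.choice inferInstance := by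
    refine fun z hz => Function.invFunOn_neg ?_
    rintro ⟨w, hw, rfl⟩
    have hle : -1 * Real.exp (-1) ≤ w * Real.exp w :=
      strictMonoOn_mul_exp.monotoneOn Set.self_mem_Ici hw hw
    linarith
  refine measurable_of_restrict_of_restrict_compl (measurableSet_Ici (a := -Real.exp (-1)))
    (Set.monotoneOn_iff_monotone.1 monotoneOn_lambertW0).measurable ?_
  have hrestrict : (Set.Ici (-Real.exp (-1)))ᶜ.domRestrict lambertW0 =
      fun _ => Classical.choice inferInstance := by
    funext z
    exact hconst z (not_le.1 z.2)
  rw [hrestrict]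
  exact measurable_const

end LambertW

section ServiceCost

variable {R : Type*} (p : Params R) {X ψ : ℝ}

lemma exp_mul_le_exp (x y : ℝ) : Real.exp y * (x - y + 1) ≤ Real.exp x :=
  calc Real.exp y * (x - y + 1) ≤ Real.exp y * Real.exp (x - y) := by
        gcongr
        exact Real.add_one_le_exp _
    _ = Real.exp x := by rw [← Real.exp_add, add_sub_cancel]

lemma antitoneOn_exp_mul_one_sub :
    AntitoneOn (fun y => Real.exp y * (1 - y)) (Set.Ici 0) := by
  intro a ha b _ hab
  have hexp := mul_le_mul_of_nonneg_left (Real.exp_le_exp.2 hab) ha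
  linarith [exp_mul_le_exp a b]

/-- The cost, in the objective maximized by the algorithm, of serving an RT user with power `P` for
the time `m`: the energy weighted with the virtual power queue, plus the value `ψ` per unit of time
that the NRT user loses. -/
noncomputable def serviceCost (X ψ P m : ℝ) : ℝ := X * P * m / p.T + ψ * m

/-- The derivative of `serviceCost` with respect to the duration, when the power
`Real.exp (L / m) - 1` delivers one packet, as a function of the rate `y = L / m`. -/
noncomputable def costSlope (X ψ y : ℝ) : ℝ := X / p.T * (Real.exp y * (1 - y) - 1) + ψ

variable {p}

lemma antitoneOn_costSlope (hX : 0 ≤ X) : AntitoneOn (costSlope p X ψ) (Set.Ici 0) := by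
  intro a ha b hb hab
  have := p.T_pos
  have := antitoneOn_exp_mul_one_sub ha hb hab
  unfold costSlope
  gcongr

lemma tangent_le_serviceCost {P m : ℝ} (hX : 0 ≤ X) (hP : 0 ≤ P) (hm : 0 ≤ m)
    (hpacket : m * Real.log (1 + P) = p.L) (y : ℝ) :
    X / p.T * (p.L * Real.exp y) + costSlope p X ψ y * m ≤ serviceCost p X ψ P m := by
  have := p.T_pos
  have htangent := exp_mul_le_exp (Real.log (1 + P)) y
  rw [Real.exp_log (by linarith)] at htangent
  calc X / p.T * (p.L * Real.exp y) + costSlope p X ψ y * m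
      = X / p.T * (m * (Real.exp y * (Real.log (1 + P) - y + 1) - 1)) + ψ * m := by
        rw [costSlope, ← hpacket]
        ring
    _ ≤ X / p.T * (m * (1 + P - 1)) + ψ * m := by gcongr
    _ = serviceCost p X ψ P m := by
        rw [serviceCost]
        ring

lemma tangent_eq_serviceCost {P m : ℝ} (hP : 0 ≤ P) (hpacket : m * Real.log (1 + P) = p.L) :
    X / p.T * (p.L * Real.exp (Real.log (1 + P))) + costSlope p X ψ (Real.log (1 + P)) * m =
      serviceCost p X ψ P m := by
  rw [costSlope, serviceCost, Real.exp_log (by linarith), ← hpacket]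
  ring

end ServiceCost

section LambertPower

variable {R : Type*} {p : Params R} {X ψ : ℝ}

lemma exists_lambertPower_eq (hX : 0 < X) (hψ : 0 ≤ ψ) :
    ∃ y, 0 ≤ y ∧ costSlope p X ψ y = 0 ∧ lambertPower p X ψ = min (Real.exp y - 1) p.Pmax := by
  have hT := p.T_pos
  obtain ⟨z, hz⟩ : ∃ z, z = p.T * ψ / X - 1 := ⟨_, rfl⟩
  have hz1 : -1 ≤ z := by
    have : 0 ≤ p.T * ψ / X := by positivity
    linarith
  have hze : -Real.exp (-1) ≤ z / Real.exp 1 := by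
    rw [Real.exp_neg, ← one_div, ← neg_div]
    gcongr
  set w := lambertW0 (z / Real.exp 1) with hw
  have hw1 : -1 ≤ w := neg_one_le_lambertW0 hze
  have hwz : w * Real.exp (1 + w) = z := by
    rw [Real.exp_add, mul_left_comm, lambertW0_mul_exp hze, mul_div_cancel₀ _ (Real.exp_ne_zero 1)]
  refine ⟨1 + w, by linarith, ?_, ?_⟩
  · have : Real.exp (1 + w) * (1 - (1 + w)) = -z := by linarith
    rw [costSlope, this, hz]
    field_simp
    ring
  · simp only [lambertPower, if_neg hX.ne', ← hz, ← hw]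
    congr 2
    split_ifs with h0
    · have : w = 0 := by simpa only [h0, mul_eq_zero, Real.exp_ne_zero, or_false] using hwz
      rw [this, add_zero]
    · have hw0 : w ≠ 0 := fun h => h0 (by rw [← hwz, h, zero_mul])
      rw [← hwz, mul_div_cancel_left₀ _ hw0]

lemma lambertPower_mem_Icc (hX : 0 ≤ X) (hψ : 0 ≤ ψ) :
    lambertPower p X ψ ∈ Set.Icc 0 p.Pmax := by
  have hPmax := p.Pmax_nonneg
  rcases hX.eq_or_lt with rfl | hX
  · rw [lambertPower, if_pos rfl]
    split_ifs <;> simpa using hPmax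
  · obtain ⟨y, hy, -, hpow⟩ := exists_lambertPower_eq (p := p) hX hψ
    rw [hpow]
    exact ⟨le_min (sub_nonneg.2 (Real.one_le_exp hy)) hPmax, min_le_right _ _⟩

lemma costSlope_lambertPower (hX : 0 ≤ X) (hψ : 0 ≤ ψ) :
    costSlope p X ψ (Real.log (1 + lambertPower p X ψ)) = 0 ∨
      0 ≤ costSlope p X ψ (Real.log (1 + lambertPower p X ψ)) ∧ lambertPower p X ψ = p.Pmax := by
  rcases hX.eq_or_lt with rfl | hX
  · have hslope : ∀ y, costSlope p 0 ψ y = ψ := fun y => by simp [costSlope]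
    by_cases h : ψ = 0
    · exact Or.inl (by rw [hslope, h])
    · exact Or.inr ⟨by rwa [hslope], by rw [lambertPower, if_pos rfl, if_neg h]⟩
  · obtain ⟨y, hy, hslope, hpow⟩ := exists_lambertPower_eq (p := p) hX hψ
    rcases le_total (Real.exp y - 1) p.Pmax with hc | hc
    · left
      rw [hpow, min_eq_left hc, add_sub_cancel, Real.log_exp, hslope]
    · right
      rw [hpow, min_eq_right hc]
      have hlog : Real.log (1 + p.Pmax) ≤ y :=
        (Real.log_le_iff_le_exp (by linarith [p.Pmax_nonneg])).2 (by linarith)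
      exact ⟨hslope ▸ antitoneOn_costSlope hX.le
        (Real.log_nonneg (by linarith [p.Pmax_nonneg])) hy hlog, rfl⟩

lemma costSlope_nonpos_of_lambertPower_lt {y : ℝ} (hX : 0 ≤ X) (hψ : 0 ≤ ψ)
    (hlt : lambertPower p X ψ < Real.exp y - 1) (hle : Real.exp y - 1 ≤ p.Pmax) :
    costSlope p X ψ y ≤ 0 := by
  rcases hX.eq_or_lt with rfl | hX
  · rw [lambertPower, if_pos rfl] at hlt
    split_ifs at hlt with h
    · simp [costSlope, h]
    · exact absurd hle hlt.not_ge
  · obtain ⟨y₀, hy₀, hslope, hpow⟩ := exists_lambertPower_eq (p := p) hX hψ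
    have hexp : Real.exp y₀ - 1 < Real.exp y - 1 := by
      rw [hpow, min_lt_iff] at hlt
      exact hlt.resolve_right hle.not_gt
    have hy : y₀ ≤ y := (Real.exp_lt_exp.1 (by linarith)).le
    exact hslope ▸ antitoneOn_costSlope hX.le hy₀ (hy₀.trans hy) hy

end LambertPower

section RTPower

variable {R : Type*} {p : Params R} {X ψ : ℝ} {n : ℕ}

lemma fits_of_fullSlotPower_le {P : ℝ} (hn : n ≠ 0) (hP : Real.exp (n * p.L / p.T) - 1 ≤ P) :
    0 < P ∧ n * (p.L / Real.log (1 + P)) ≤ p.T := by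
  have hT := p.T_pos
  have hL := p.L_pos
  have hpos : 0 < n * p.L / p.T := by positivity
  have hP0 : 0 < P := by linarith [Real.add_one_lt_exp hpos.ne']
  have hlog : n * p.L / p.T ≤ Real.log (1 + P) :=
    (Real.le_log_iff_exp_le (by linarith)).2 (by linarith)
  refine ⟨hP0, ?_⟩
  rw [← mul_div_assoc, div_le_iff₀ (Real.log_pos (by linarith))]
  rwa [div_le_iff₀' hT] at hlog

lemma rtPower_eq_or (hn : n ≠ 0) :
    rtPower p X ψ n = lambertPower p X ψ ∨
      rtPower p X ψ n = Real.exp (n * p.L / p.T) - 1 ∧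
        lambertPower p X ψ < Real.exp (n * p.L / p.T) - 1 := by
  unfold rtPower
  split_ifs with h
  · exact Or.inl rfl
  · exact Or.inr ⟨rfl, lt_of_not_ge fun hle => h (fits_of_fullSlotPower_le hn hle)⟩

lemma rtPower_pos (hn : n ≠ 0) : 0 < rtPower p X ψ n := by
  unfold rtPower
  split_ifs with h
  · exact h.1
  · exact (fits_of_fullSlotPower_le hn le_rfl).1

lemma rtPower_le_Pmax (hX : 0 ≤ X) (hψ : 0 ≤ ψ) (hfit : n * p.L ≤ p.T * Real.log (1 + p.Pmax)) :
    rtPower p X ψ n ≤ p.Pmax := by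
  unfold rtPower
  split_ifs
  · exact (lambertPower_mem_Icc hX hψ).2
  · have hlog : n * p.L / p.T ≤ Real.log (1 + p.Pmax) := (div_le_iff₀' p.T_pos).2 hfit
    rw [Real.le_log_iff_exp_le (by linarith [p.Pmax_nonneg])] at hlog
    linarith

lemma log_rtPower_pos (hn : n ≠ 0) : 0 < Real.log (1 + rtPower p X ψ n) :=
  Real.log_pos (by linarith [rtPower_pos (p := p) (X := X) (ψ := ψ) hn])

lemma rtDur_pos (hn : n ≠ 0) : 0 < rtDur p X ψ n := div_pos p.L_pos (log_rtPower_pos hn)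

lemma rtDur_mul_log (hn : n ≠ 0) :
    rtDur p X ψ n * Real.log (1 + rtPower p X ψ n) = p.L :=
  div_mul_cancel₀ _ (log_rtPower_pos hn).ne'

lemma mul_rtDur_eq_of_log_eq (hn : n ≠ 0)
    (hlog : Real.log (1 + rtPower p X ψ n) = n * p.L / p.T) : n * rtDur p X ψ n = p.T := by
  have := p.T_pos
  have := p.L_pos
  rw [rtDur, hlog]
  field_simp

lemma mul_rtDur_mem_Icc (X ψ : ℝ) (n : ℕ) : n * rtDur p X ψ n ∈ Set.Icc 0 p.T := by
  rcases eq_or_ne n 0 with rfl | hn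
  · simpa using p.T_pos.le
  refine ⟨mul_nonneg n.cast_nonneg (rtDur_pos hn).le, ?_⟩
  by_cases h : 0 < lambertPower p X ψ ∧ n * (p.L / Real.log (1 + lambertPower p X ψ)) ≤ p.T
  · rw [rtDur, rtPower, if_pos h]
    exact h.2
  · refine (mul_rtDur_eq_of_log_eq hn ?_).le
    rw [rtPower, if_neg h, add_sub_cancel, Real.log_exp]

/-- The first-order optimality condition: `n * rtDur` minimizes the total service cost over the
total durations `τ` that the power constraint and the slot length allow. -/
lemma costSlope_rtPower_mul_sub_nonneg (hn : n ≠ 0) (hX : 0 ≤ X) (hψ : 0 ≤ ψ) {τ : ℝ}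
    (hτT : τ ≤ p.T) (hτ : n * p.L ≤ τ * Real.log (1 + p.Pmax)) :
    0 ≤ costSlope p X ψ (Real.log (1 + rtPower p X ψ n)) * (τ - n * rtDur p X ψ n) := by
  have hle : rtPower p X ψ n ≤ p.Pmax := rtPower_le_Pmax hX hψ <| hτ.trans <|
    mul_le_mul_of_nonneg_right hτT (Real.log_nonneg (by linarith [p.Pmax_nonneg]))
  rcases rtPower_eq_or (p := p) (X := X) (ψ := ψ) hn with hpow | ⟨hpow, hlt⟩
  · rcases costSlope_lambertPower (p := p) hX hψ with hslope | ⟨hslope, hmax⟩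
    · rw [hpow, hslope, zero_mul]
    · rw [← hpow] at hslope hmax
      refine mul_nonneg hslope (sub_nonneg.2 ?_)
      rw [rtDur, ← mul_div_assoc, div_le_iff₀ (log_rtPower_pos hn), hmax]
      exact hτ
  · have hlog : Real.log (1 + rtPower p X ψ n) = n * p.L / p.T := by
      rw [hpow, add_sub_cancel, Real.log_exp]
    rw [mul_rtDur_eq_of_log_eq hn hlog, hlog]
    exact mul_nonneg_of_nonpos_of_nonpos
      (costSlope_nonpos_of_lambertPower_lt hX hψ hlt (hpow ▸ hle)) (sub_nonpos.2 hτT)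

lemma card_mul_serviceCost_le_sum {ι : Type*} (S : Finset ι) {P m : ι → ℝ} (hX : 0 ≤ X)
    (hψ : 0 ≤ ψ) (hP : ∀ i ∈ S, 0 ≤ P i) (hm : ∀ i ∈ S, 0 ≤ m i)
    (hpacket : ∀ i ∈ S, m i * Real.log (1 + P i) = p.L) (hsum : ∑ i ∈ S, m i ≤ p.T)
    (hfit : S.card * p.L ≤ (∑ i ∈ S, m i) * Real.log (1 + p.Pmax)) :
    S.card * serviceCost p X ψ (rtPower p X ψ S.card) (rtDur p X ψ S.card) ≤
      ∑ i ∈ S, serviceCost p X ψ (P i) (m i) := by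
  rcases S.eq_empty_or_nonempty with rfl | hS
  · simp
  set y := Real.log (1 + rtPower p X ψ S.card) with hy
  have hslope := costSlope_rtPower_mul_sub_nonneg hS.card_ne_zero hX hψ hsum hfit
  rw [← hy, mul_sub] at hslope
  calc S.card * serviceCost p X ψ (rtPower p X ψ S.card) (rtDur p X ψ S.card)
      = S.card * (X / p.T * (p.L * Real.exp y)) +
          costSlope p X ψ y * (S.card * rtDur p X ψ S.card) := by
        rw [← tangent_eq_serviceCost (rtPower_pos hS.card_ne_zero).le
          (rtDur_mul_log hS.card_ne_zero)]
        ring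
    _ ≤ S.card * (X / p.T * (p.L * Real.exp y)) + costSlope p X ψ y * ∑ i ∈ S, m i := by
        linarith
    _ = ∑ i ∈ S, (X / p.T * (p.L * Real.exp y) + costSlope p X ψ y * m i) := by
        rw [Finset.sum_add_distrib, Finset.sum_const, nsmul_eq_mul, Finset.mul_sum]
    _ ≤ ∑ i ∈ S, serviceCost p X ψ (P i) (m i) := Finset.sum_le_sum fun i hi =>
        tangent_le_serviceCost hX (hP i hi) (hm i hi) (hpacket i hi) y

end RTPower

section WaterFilling

/-- `min (max t 0) M` is the projection of `t` to `[0, M]`; this is its variational inequality. -/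
lemma sub_clamp_mul_sub_clamp_nonpos {t M x : ℝ} (hM : 0 ≤ M) (hx : x ∈ Set.Icc 0 M) :
    (x - min (max t 0) M) * (t - min (max t 0) M) ≤ 0 := by
  obtain ⟨hx0, hxM⟩ := hx
  rcases le_total t 0 with ht | ht
  · rw [max_eq_right ht, min_eq_left hM]
    exact mul_nonpos_of_nonneg_of_nonpos (by linarith) (by linarith)
  rw [max_eq_left ht]
  rcases le_total t M with htM | htM
  · rw [min_eq_left htM, sub_self, mul_zero]
  · rw [min_eq_right htM]
    exact mul_nonpos_of_nonpos_of_nonneg (by linarith) (by linarith)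

lemma log_one_add_sub_log_one_add_le {x y : ℝ} (hx : 0 ≤ x) (hy : 0 ≤ y) :
    Real.log (1 + x) - Real.log (1 + y) ≤ (x - y) / (1 + y) := by
  rw [← Real.log_div (by linarith) (by linarith)]
  refine (Real.log_le_sub_one_of_pos (by positivity)).trans_eq ?_
  field_simp
  ring

lemma waterFilling_optimal {Q c M P : ℝ} (hQ : 0 ≤ Q) (hc : 0 < c) (hP : P ∈ Set.Icc 0 M) :
    Q * Real.log (1 + P) - c * P ≤
      Q * Real.log (1 + min (max (Q / c - 1) 0) M) - c * min (max (Q / c - 1) 0) M := by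
  have hM : 0 ≤ M := hP.1.trans hP.2
  have hproj := sub_clamp_mul_sub_clamp_nonpos (t := Q / c - 1) hM hP
  have h0 : 0 ≤ min (max (Q / c - 1) 0) M := le_min (le_max_right _ _) hM
  set P₀ := min (max (Q / c - 1) 0) M
  have htangent := mul_le_mul_of_nonneg_left (log_one_add_sub_log_one_add_le hP.1 h0) hQ
  have hfirst : Q * ((P - P₀) / (1 + P₀)) - c * (P - P₀) =
      c / (1 + P₀) * ((P - P₀) * (Q / c - 1 - P₀)) := by
    field_simp
    ring
  have hscale : 0 ≤ c / (1 + P₀) := by positivity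
  linarith [mul_nonpos_of_nonneg_of_nonpos hscale hproj]

variable {R N : Type*} {p : Params R} {u : State R N} {s : Slot R N} {i : N}

lemma nrtPower_mem_Icc (p : Params R) (u : State R N) (s : Slot R N) (i : N) :
    nrtPower p u s i ∈ Set.Icc 0 p.Pmax := by
  have hPmax := p.Pmax_nonneg
  unfold nrtPower
  split_ifs
  · exact ⟨le_rfl, hPmax⟩
  · exact ⟨le_rfl, hPmax⟩
  · exact ⟨hPmax, le_rfl⟩
  · exact ⟨le_min (le_max_right _ _) hPmax, min_le_right _ _⟩

lemma le_psiNR (hQ : 0 ≤ u.Q i) (hX : 0 ≤ u.X) {P : ℝ} (hP : P ∈ Set.Icc 0 p.Pmax) :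
    u.Q i * Real.log (1 + P * ind (s.2 (Sum.inr i))) - u.X * P / p.T ≤ psiNR p u s i := by
  have hT := p.T_pos
  have hP0 := hP.1
  unfold psiNR nrtPower
  cases hs : s.2 (Sum.inr i)
  · have : 0 ≤ u.X * P / p.T := by positivity
    simpa [ind] using this
  simp only [ind, if_true, mul_one, Bool.true_eq_false, if_false]
  rcases hX.eq_or_lt with hX | hX
  · simp only [← hX, if_true, zero_mul, zero_div, sub_zero]
    split_ifs with h
    · simp [h]
    · have := hP.2
      gcongr
  · have hopt := waterFilling_optimal hQ (div_pos hX hT) hP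
    have hlevel : u.Q i / (u.X / p.T) = p.T * u.Q i / u.X := by
      field_simp
    rw [hlevel] at hopt
    simpa only [if_neg hX.ne', div_mul_eq_mul_div] using hopt

lemma psiNR_nonneg (hQ : 0 ≤ u.Q i) (hX : 0 ≤ u.X) : 0 ≤ psiNR p u s i := by
  simpa using le_psiNR (p := p) (s := s) hQ hX (P := 0) ⟨le_rfl, p.Pmax_nonneg⟩

lemma IsLongest.le_psiNR {i₀ : N} (hi₀ : IsLongest u s i₀) (hu : u.Nonneg) (i : N) {P : ℝ}
    (hP : P ∈ Set.Icc 0 p.Pmax) :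
    u.Q i * Real.log (1 + P * ind (s.2 (Sum.inr i))) - u.X * P / p.T ≤ psiNR p u s i₀ := by
  have hT := p.T_pos
  have hP0 := hP.1
  obtain ⟨-, hQ, hX⟩ := hu
  cases hs : s.2 (Sum.inr i)
  · have hcost : 0 ≤ u.X * P / p.T := by positivity
    have hψ := psiNR_nonneg (p := p) (s := s) (hQ i₀) hX
    simp only [ind, Bool.false_eq_true, if_false, mul_zero, add_zero, Real.log_one]
    linarith
  · rcases hi₀ with ⟨hon, hlongest⟩ | hoff
    · refine le_trans ?_ (RTNRT.le_psiNR (s := s) (hQ i₀) hX hP)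
      have hlog : 0 ≤ Real.log (1 + P) := Real.log_nonneg (by linarith)
      have hQle := hlongest i hs
      simp only [hon, ind, if_true, mul_one]
      gcongr
    · simp [hoff i] at hs

end WaterFilling

section LargestValues

lemma exists_card_eq_and_sum_le_sum {ι M : Type*} [AddCommMonoid M] [LinearOrder M]
    [IsOrderedCancelAddMonoid M] (f : ι → M) {E S : Finset ι} (hS : S ⊆ E) :
    ∃ S' ⊆ E, S'.card = S.card ∧ (∀ i ∈ S', ∀ j ∈ E, j ∉ S' → f j ≤ f i) ∧
      ∑ i ∈ S, f i ≤ ∑ i ∈ S', f i := by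
  classical
  obtain ⟨S', hmem, hmax⟩ := (E.powersetCard S.card).exists_max_image (fun A => ∑ i ∈ A, f i)
    ⟨S, Finset.mem_powersetCard.2 ⟨hS, rfl⟩⟩
  obtain ⟨hS'E, hcard⟩ := Finset.mem_powersetCard.1 hmem
  refine ⟨S', hS'E, hcard, fun i hi j hjE hj => ?_, hmax S (Finset.mem_powersetCard.2 ⟨hS, rfl⟩)⟩
  have hj' : j ∉ S'.erase i := fun h => hj (Finset.mem_of_mem_erase h)
  have hexchange := hmax (insert j (S'.erase i)) <| Finset.mem_powersetCard.2
    ⟨Finset.insert_subset hjE ((Finset.erase_subset _ _).trans hS'E), by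
      rw [Finset.card_insert_of_notMem hj', Finset.card_erase_add_one hi, hcard]⟩
  rw [Finset.sum_insert hj', ← Finset.add_sum_erase S' f hi] at hexchange
  exact le_of_add_le_add_right hexchange

end LargestValues

section ValidActions

variable {R N : Type*}

lemma ind_nonneg (b : Bool) : 0 ≤ ind b := by cases b <;> simp [ind]

lemma ind_le_one (b : Bool) : ind b ≤ 1 := by cases b <;> simp [ind]

open Classical in
/-- The indicator `1[μ_i ≠ 0]` of the event that the RT user `i` is scheduled. -/
noncomputable def served (d : Action R N) (i : R) : ℝ := if d.dur (Sum.inl i) ≠ 0 then 1 else 0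

lemma served_mem_Icc (d : Action R N) (i : R) : served d i ∈ Set.Icc (0 : ℝ) 1 := by
  unfold served
  split_ifs <;> simp

variable [Fintype R] [Fintype N] {p : Params R} {s : Slot R N} {d : Action R N}

namespace Action.Valid

lemma rate_nonneg (hd : d.Valid p s) (j : R ⊕ N) : 0 ≤ rate s d j :=
  Real.log_nonneg (by linarith [mul_nonneg (hd.pow_mem j).1 (ind_nonneg (s.2 j))])

lemma rate_le (hd : d.Valid p s) (j : R ⊕ N) : rate s d j ≤ Real.log (1 + p.Pmax) := by
  have hnonneg := mul_nonneg (hd.pow_mem j).1 (ind_nonneg (s.2 j))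
  have hle : d.pow j * ind (s.2 j) ≤ p.Pmax :=
    (mul_le_of_le_one_right (hd.pow_mem j).1 (ind_le_one _)).trans (hd.pow_mem j).2
  unfold rate
  gcongr

lemma channel_on (hd : d.Valid p s) {i : R} (hi : d.dur (Sum.inl i) ≠ 0) :
    s.2 (Sum.inl i) = true := by
  by_contra hoff
  have hbits := (hd.rt i hi).2
  simp only [rate, ind, hoff, if_false, mul_zero, add_zero, Real.log_one] at hbits
  exact p.L_pos.ne hbits

lemma dur_mul_rate_inl (hd : d.Valid p s) (i : R) :
    d.dur (Sum.inl i) * rate s d (Sum.inl i) = p.L * served d i := by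
  unfold served
  split_ifs with h
  · rw [(hd.rt i h).2, mul_one]
  · rw [not_not.1 h, zero_mul, mul_zero]

lemma dur_mul_log_one_add (hd : d.Valid p s) {i : R} (hi : d.dur (Sum.inl i) ≠ 0) :
    d.dur (Sum.inl i) * Real.log (1 + d.pow (Sum.inl i)) = p.L := by
  simpa only [rate, hd.channel_on hi, ind, if_true, mul_one] using (hd.rt i hi).2

end Action.Valid

end ValidActions

section CandidateSets

variable {R N : Type*} {p : Params R} {ψ : ℝ} {u : State R N} {s : Slot R N}

lemma psiAux_eq (S : Finset R) :
    psiAux p u ψ S = ∑ i ∈ S, u.Y i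
      - S.card * serviceCost p u.X ψ (rtPower p u.X ψ S.card) (rtDur p u.X ψ S.card)
      + ψ * p.T := by
  rw [psiAux, serviceCost, Finset.sum_sub_distrib, Finset.sum_const, nsmul_eq_mul]
  ring

lemma exists_isCandidate_psiAux_le [Finite R] {S : Finset R}
    (helig : ∀ i ∈ S, s.1 (Sum.inl i) = true ∧ s.2 (Sum.inl i) = true)
    (hpow : rtPower p u.X ψ S.card ≤ p.Pmax) :
    ∃ S', IsCandidate p u s ψ S' ∧ psiAux p u ψ S ≤ psiAux p u ψ S' := by
  obtain ⟨S', hS', hcard, hlargest, hsum⟩ := exists_card_eq_and_sum_le_sum u.Y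
    (E := (Set.toFinite {i | s.1 (Sum.inl i) = true ∧ s.2 (Sum.inl i) = true}).toFinset)
    (fun i hi => by simpa using helig i hi)
  refine ⟨S', ⟨fun i hi => by simpa using hS' hi, fun i hi j hj harr hon =>
    hlargest i hi j (by simp [harr, hon]) hj, hcard ▸ hpow⟩, ?_⟩
  rw [psiAux_eq, psiAux_eq, hcard]
  gcongr

lemma isCandidate_empty (hX : 0 ≤ u.X) (hψ : 0 ≤ ψ) : IsCandidate p u s ψ ∅ where
  eligible := by simp
  largest := by simp
  pow_le := rtPower_le_Pmax hX hψ <| by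
    simpa using mul_nonneg p.T_pos.le (Real.log_nonneg (by linarith [p.Pmax_nonneg]))

end CandidateSets

section ScheduledUsers

variable {R N : Type*} [Fintype R] {p : Params R} {u : State R N} {d : Action R N}

open Classical in
/-- The set of RT users that are scheduled by `d`. -/
noncomputable def scheduled (d : Action R N) : Finset R :=
  Finset.univ.filter fun i => d.dur (Sum.inl i) ≠ 0

lemma mem_scheduled {i : R} : i ∈ scheduled d ↔ d.dur (Sum.inl i) ≠ 0 := by
  simp [scheduled]

lemma sum_served_sub_energy :
    ∑ i, (u.Y i * served d i - u.X * (d.pow (Sum.inl i) * d.dur (Sum.inl i)) / p.T) =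
      ∑ i ∈ scheduled d, (u.Y i - u.X * (d.pow (Sum.inl i) * d.dur (Sum.inl i)) / p.T) := by
  rw [scheduled, Finset.sum_filter]
  refine Finset.sum_congr rfl fun i _ => ?_
  unfold served
  split_ifs with h
  · rw [mul_one]
  · rw [not_not.1 h]
    simp

end ScheduledUsers

section Gain

variable {R N : Type*} [Fintype R] [Fintype N] {p : Params R} {B : ℝ} {u : State R N}
  {s : Slot R N} {d : Action R N}

/-- The part of the one-slot Lyapunov drift, with reversed sign, that depends on the decision,
including the reward `B L` for each admitted packet. -/
noncomputable def gain (p : Params R) (B : ℝ) (u : State R N) (s : Slot R N) (d : Action R N) : ℝ :=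
  ∑ i, u.Y i * served d i - u.X * slotPower p d
    + ∑ i, u.Q i * (d.dur (Sum.inr i) * rate s d (Sum.inr i))
    + ∑ i, (B - u.Q i) * (p.L * ind (d.adm i))

lemma gain_eq :
    gain p B u s d =
      ∑ i, (u.Y i * served d i - u.X * (d.pow (Sum.inl i) * d.dur (Sum.inl i)) / p.T)
      + ∑ i, d.dur (Sum.inr i) * (u.Q i * rate s d (Sum.inr i) - u.X * d.pow (Sum.inr i) / p.T)
      + ∑ i, (B - u.Q i) * (p.L * ind (d.adm i)) := by
  have hN : ∑ i, d.dur (Sum.inr i) * (u.Q i * rate s d (Sum.inr i)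
        - u.X * d.pow (Sum.inr i) / p.T) =
      ∑ i, u.Q i * (d.dur (Sum.inr i) * rate s d (Sum.inr i)) -
        u.X / p.T * ∑ i, d.pow (Sum.inr i) * d.dur (Sum.inr i) := by
    rw [Finset.mul_sum, ← Finset.sum_sub_distrib]
    exact Finset.sum_congr rfl fun i _ => by ring
  rw [gain, slotPower, Fintype.sum_sum_type, hN, Finset.sum_sub_distrib, ← Finset.sum_div,
    ← Finset.mul_sum]
  ring

/-- The largest admission part of `gain` over valid decisions: a packet is admitted exactly where
the threshold `B` of the algorithm allows it. -/
noncomputable def admGain (p : Params R) (B : ℝ) (u : State R N) (s : Slot R N) : ℝ :=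
  ∑ i, (B - u.Q i) * (p.L * ind (if u.Q i < B then s.1 (Sum.inr i) else false))

lemma Action.Valid.sum_admission_le_admGain (hd : d.Valid p s) :
    ∑ i, (B - u.Q i) * (p.L * ind (d.adm i)) ≤ admGain p B u s := by
  have hL := p.L_pos
  refine Finset.sum_le_sum fun i _ => ?_
  split_ifs with h
  · have hind : ind (d.adm i) ≤ ind (s.1 (Sum.inr i)) := by
      rcases hadm : d.adm i with _ | _
      · exact ind_nonneg _
      · rw [hd.adm_le i hadm]
    have : 0 ≤ B - u.Q i := by linarith
    gcongr
  · simp only [ind, Bool.false_eq_true, if_false, mul_zero]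
    exact mul_nonpos_of_nonpos_of_nonneg (by linarith) (mul_nonneg hL.le (ind_nonneg _))

namespace Action.Valid

lemma sum_scheduled_dur (hd : d.Valid p s) :
    ∑ i ∈ scheduled d, d.dur (Sum.inl i) = p.T - ∑ i, d.dur (Sum.inr i) := by
  rw [← hd.sum_dur, Fintype.sum_sum_type, scheduled, Finset.sum_filter_ne_zero,
    add_sub_cancel_right]

lemma sum_scheduled_dur_le (hd : d.Valid p s) :
    ∑ i ∈ scheduled d, d.dur (Sum.inl i) ≤ p.T := by
  rw [hd.sum_scheduled_dur]
  exact sub_le_self _ (Finset.sum_nonneg fun i _ => (hd.dur_mem _).1)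

lemma card_scheduled_mul_le (hd : d.Valid p s) :
    (scheduled d).card * p.L ≤
      (∑ i ∈ scheduled d, d.dur (Sum.inl i)) * Real.log (1 + p.Pmax) := by
  rw [← nsmul_eq_mul, ← Finset.sum_const, Finset.sum_mul]
  refine Finset.sum_le_sum fun i hi => ?_
  rw [← (hd.rt i (mem_scheduled.1 hi)).2]
  exact mul_le_mul_of_nonneg_left (hd.rate_le _) (hd.dur_mem _).1

lemma sum_nrt_le (hd : d.Valid p s) (hu : u.Nonneg) {i₀ : N} (hi₀ : IsLongest u s i₀) :
    ∑ i, d.dur (Sum.inr i) * (u.Q i * rate s d (Sum.inr i) - u.X * d.pow (Sum.inr i) / p.T) ≤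
      psiNR p u s i₀ * ∑ i, d.dur (Sum.inr i) := by
  rw [mul_comm, Finset.sum_mul]
  exact Finset.sum_le_sum fun i _ =>
    mul_le_mul_of_nonneg_left (hi₀.le_psiNR hu i (hd.pow_mem _)) (hd.dur_mem _).1

lemma gain_le_psiAux_scheduled (hd : d.Valid p s) (hu : u.Nonneg) {i₀ : N}
    (hi₀ : IsLongest u s i₀) :
    gain p B u s d ≤ psiAux p u (psiNR p u s i₀) (scheduled d) + admGain p B u s := by
  set ψ := psiNR p u s i₀
  have hcost := card_mul_serviceCost_le_sum (X := u.X) (ψ := ψ) (scheduled d) hu.2.2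
    (psiNR_nonneg (hu.2.1 i₀) hu.2.2) (fun i _ => (hd.pow_mem (Sum.inl i)).1)
    (fun i _ => (hd.dur_mem (Sum.inl i)).1)
    (fun i hi => hd.dur_mul_log_one_add (mem_scheduled.1 hi))
    hd.sum_scheduled_dur_le hd.card_scheduled_mul_le
  simp only [serviceCost, Finset.sum_add_distrib, ← Finset.mul_sum, hd.sum_scheduled_dur,
    mul_assoc] at hcost
  rw [gain_eq, sum_served_sub_energy, psiAux_eq, Finset.sum_sub_distrib, serviceCost, mul_assoc]
  linarith [hd.sum_nrt_le hu hi₀, hd.sum_admission_le_admGain (B := B) (u := u)]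

end Action.Valid

lemma Action.Valid.exists_isCandidate_gain_le (hd : d.Valid p s) (hu : u.Nonneg) {i₀ : N}
    (hi₀ : IsLongest u s i₀) :
    ∃ S, IsCandidate p u s (psiNR p u s i₀) S ∧
      gain p B u s d ≤ psiAux p u (psiNR p u s i₀) S + admGain p B u s := by
  have hfit := hd.card_scheduled_mul_le.trans <| mul_le_mul_of_nonneg_right
    hd.sum_scheduled_dur_le (Real.log_nonneg (by linarith [p.Pmax_nonneg]))
  obtain ⟨S, hS, hle⟩ := exists_isCandidate_psiAux_le (p := p) (u := u) (s := s)
    (S := scheduled d)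
    (fun i hi => ⟨(hd.rt i (mem_scheduled.1 hi)).1, hd.channel_on (mem_scheduled.1 hi)⟩)
    (rtPower_le_Pmax hu.2.2 (psiNR_nonneg (s := s) (hu.2.1 i₀) hu.2.2) hfit)
  exact ⟨S, hS, (hd.gain_le_psiAux_scheduled hu hi₀).trans (by gcongr)⟩

end Gain

section Choices

variable {R N : Type*} {p : Params R} {B : ℝ} {u : State R N} {s : Slot R N} {d : Action R N}
  {c : N × Finset R}

/-- `c` is a possible outcome of the first three steps of the algorithm: the NRT user `i*` and the
set of scheduled RT users. -/
structure IsChoice (p : Params R) (u : State R N) (s : Slot R N) (c : N × Finset R) : Prop where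
  longest : IsLongest u s c.1
  candidate : IsCandidate p u s (psiNR p u s c.1) c.2
  best : ∀ S, IsCandidate p u s (psiNR p u s c.1) S →
    psiAux p u (psiNR p u s c.1) S ≤ psiAux p u (psiNR p u s c.1) c.2

open Classical in
/-- The decision in the last step of the algorithm, given the NRT user and the RT users to be
served. -/
noncomputable def choiceAction (p : Params R) (B : ℝ) (u : State R N) (s : Slot R N)
    (c : N × Finset R) : Action R N where
  dur := Sum.elim
    (fun i => if i ∈ c.2 then rtDur p u.X (psiNR p u s c.1) c.2.card else 0)
    (fun i => if i = c.1 then p.T - c.2.card * rtDur p u.X (psiNR p u s c.1) c.2.card else 0)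
  pow := Sum.elim
    (fun i => if i ∈ c.2 then rtPower p u.X (psiNR p u s c.1) c.2.card else 0)
    (fun i => if i = c.1 then nrtPower p u s c.1 else 0)
  adm i := if u.Q i < B then s.1 (Sum.inr i) else false

lemma isAlgDecision_iff :
    IsAlgDecision p B u s d ↔ ∃ c, IsChoice p u s c ∧ d = choiceAction p B u s c := by
  constructor
  · rintro ⟨i₀, S, hi₀, hS, hbest, hpowR, hdurR, hpowN, hdurN, hadm⟩
    refine ⟨(i₀, S), ⟨hi₀, hS, hbest⟩, ?_⟩
    obtain ⟨dur, pow, adm⟩ := d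
    rw [choiceAction, Action.mk.injEq]
    exact ⟨funext (Sum.rec hdurR hdurN), funext (Sum.rec hpowR hpowN), funext hadm⟩
  · rintro ⟨c, hc, rfl⟩
    exact ⟨c.1, c.2, hc.longest, hc.candidate, hc.best, fun _ => rfl, fun _ => rfl, fun _ => rfl,
      fun _ => rfl, fun _ => rfl⟩

lemma IsChoice.pow_mem_Icc (hc : IsChoice p u s c) (j : R ⊕ N) :
    (choiceAction p B u s c).pow j ∈ Set.Icc 0 p.Pmax := by
  have hzero : (0 : ℝ) ∈ Set.Icc 0 p.Pmax := ⟨le_rfl, p.Pmax_nonneg⟩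
  rcases j with i | i <;> simp only [choiceAction, Sum.elim_inl, Sum.elim_inr] <;> split_ifs with hi
  · exact ⟨(rtPower_pos (Finset.card_ne_zero_of_mem hi)).le, hc.candidate.pow_le⟩
  · exact hzero
  · exact nrtPower_mem_Icc p u s c.1
  · exact hzero

lemma choiceAction_dur_mem_Icc (j : R ⊕ N) :
    (choiceAction p B u s c).dur j ∈ Set.Icc 0 p.T := by
  have hzero : (0 : ℝ) ∈ Set.Icc 0 p.T := ⟨le_rfl, p.T_pos.le⟩
  have htotal := mul_rtDur_mem_Icc (p := p) u.X (psiNR p u s c.1) c.2.card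
  rcases j with i | i <;> simp only [choiceAction, Sum.elim_inl, Sum.elim_inr] <;> split_ifs with hi
  · have hpos := rtDur_pos (p := p) (X := u.X) (ψ := psiNR p u s c.1)
      (Finset.card_ne_zero_of_mem hi)
    have hcard : (1 : ℝ) ≤ c.2.card := by exact_mod_cast Finset.card_pos.2 ⟨i, hi⟩
    exact ⟨hpos.le, (le_mul_of_one_le_left hpos.le hcard).trans htotal.2⟩
  · exact hzero
  · exact ⟨sub_nonneg.2 htotal.2, sub_le_self _ htotal.1⟩
  · exact hzero

lemma choiceAction_dur_inl_ne_zero {i : R} :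
    (choiceAction p B u s c).dur (Sum.inl i) ≠ 0 ↔ i ∈ c.2 := by
  simp only [choiceAction, Sum.elim_inl, ne_eq, ite_eq_right_iff, not_forall, exists_prop,
    and_iff_left_iff_imp]
  exact fun hi => (rtDur_pos (Finset.card_ne_zero_of_mem hi)).ne'

variable [Fintype R]

lemma scheduled_choiceAction : scheduled (choiceAction p B u s c) = c.2 := by
  ext i
  rw [mem_scheduled, choiceAction_dur_inl_ne_zero]

variable [Fintype N]

lemma IsChoice.valid (hc : IsChoice p u s c) : (choiceAction p B u s c).Valid p s where
  adm_le i hi := by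
    simp only [choiceAction] at hi
    split_ifs at hi
    exact hi
  pow_mem := hc.pow_mem_Icc
  dur_mem := choiceAction_dur_mem_Icc
  sum_dur := by
    classical
    simp [choiceAction, Fintype.sum_sum_type]
  rt i hi := by
    have hmem := choiceAction_dur_inl_ne_zero.1 hi
    obtain ⟨harr, hon⟩ := hc.candidate.eligible i hmem
    refine ⟨harr, ?_⟩
    simp only [choiceAction, rate, Sum.elim_inl, hon, ind, if_pos hmem, if_true, mul_one]
    exact rtDur_mul_log (Finset.card_ne_zero_of_mem hmem)

lemma gain_choiceAction :
    gain p B u s (choiceAction p B u s c) =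
      psiAux p u (psiNR p u s c.1) c.2 + admGain p B u s := by
  rw [gain_eq, sum_served_sub_energy, scheduled_choiceAction, psiAux, admGain]
  congr 2
  · refine Finset.sum_congr rfl fun i hi => ?_
    simp only [choiceAction, Sum.elim_inl, if_pos hi, mul_assoc]
  · rw [Finset.sum_eq_single c.1 (fun i _ hi => by simp [choiceAction, hi]) (by simp)]
    simp only [choiceAction, rate, psiNR, Sum.elim_inr, if_true]
    ring

lemma IsAlgDecision.valid (h : IsAlgDecision p B u s d) : d.Valid p s := by
  obtain ⟨c, hc, rfl⟩ := isAlgDecision_iff.1 h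
  exact hc.valid

lemma IsAlgDecision.gain_le (h : IsAlgDecision p B u s d) (hu : u.Nonneg) {d' : Action R N}
    (hd' : d'.Valid p s) : gain p B u s d' ≤ gain p B u s d := by
  obtain ⟨c, hc, rfl⟩ := isAlgDecision_iff.1 h
  obtain ⟨S, hS, hle⟩ := hd'.exists_isCandidate_gain_le (B := B) hu hc.longest
  rw [gain_choiceAction]
  exact hle.trans (by gcongr; exact hc.best S hS)

end Choices

section Existence

variable {R N : Type*} [Finite N] [Nonempty N]

lemma exists_isLongest (u : State R N) (s : Slot R N) : ∃ i, IsLongest u s i := by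
  by_cases h : ∃ i : N, s.2 (Sum.inr i) = true
  · obtain ⟨i, hi, hmax⟩ :=
      (Set.toFinite {i : N | s.2 (Sum.inr i) = true}).exists_maximalFor u.Q _ h
    exact ⟨i, Or.inl ⟨hi, fun j hj => (le_total _ _).elim (hmax hj) id⟩⟩
  · push Not at h
    exact ⟨Classical.arbitrary N, Or.inr fun j => by simpa using h j⟩

lemma exists_isChoice [Finite R] {p : Params R} {u : State R N} (hu : u.Nonneg) (s : Slot R N) :
    ∃ c, IsChoice p u s c := by
  obtain ⟨i₀, hi₀⟩ := exists_isLongest u s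
  obtain ⟨S, hS, hbest⟩ :=
    (Set.toFinite {S | IsCandidate p u s (psiNR p u s i₀) S}).exists_maximalFor
      (psiAux p u (psiNR p u s i₀)) _
      ⟨∅, isCandidate_empty hu.2.2 (psiNR_nonneg (hu.2.1 i₀) hu.2.2)⟩
  exact ⟨(i₀, S), hi₀, hS, fun S' hS' => (le_total _ _).elim (hbest hS') id⟩

end Existence

section MeasurableSpaces

variable {R N : Type*}

instance : MeasurableSpace (State R N) :=
  MeasurableSpace.comap (fun u => (u.Y, u.Q, u.X)) inferInstance

instance : MeasurableSpace (Action R N) :=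
  MeasurableSpace.comap (fun d => (d.dur, d.pow, d.adm)) inferInstance

lemma State.measurable_coords : Measurable fun u : State R N => (u.Y, u.Q, u.X) :=
  comap_measurable _

@[fun_prop]
lemma State.measurable_Y (i : R) : Measurable fun u : State R N => u.Y i :=
  (measurable_pi_apply i).comp State.measurable_coords.fst

@[fun_prop]
lemma State.measurable_Q (i : N) : Measurable fun u : State R N => u.Q i :=
  (measurable_pi_apply i).comp State.measurable_coords.snd.fst

@[fun_prop]
lemma State.measurable_X : Measurable fun u : State R N => u.X :=
  State.measurable_coords.snd.snd

lemma Action.measurable_coords : Measurable fun d : Action R N => (d.dur, d.pow, d.adm) :=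
  comap_measurable _

@[fun_prop]
lemma Action.measurable_dur (j : R ⊕ N) : Measurable fun d : Action R N => d.dur j :=
  (measurable_pi_apply j).comp Action.measurable_coords.fst

@[fun_prop]
lemma Action.measurable_pow (j : R ⊕ N) : Measurable fun d : Action R N => d.pow j :=
  (measurable_pi_apply j).comp Action.measurable_coords.snd.fst

@[fun_prop]
lemma Action.measurable_adm (i : N) : Measurable fun d : Action R N => d.adm i :=
  (measurable_pi_apply i).comp Action.measurable_coords.snd.snd

@[fun_prop]
lemma measurable_ind : Measurable ind := Measurable.of_discrete

variable {α : Type*} {mα : MeasurableSpace α}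

lemma State.measurable_of_coords {f : α → State R N} (hY : ∀ i, Measurable fun x => (f x).Y i)
    (hQ : ∀ i, Measurable fun x => (f x).Q i) (hX : Measurable fun x => (f x).X) :
    Measurable f :=
  measurable_comap_iff.2
    ((measurable_pi_lambda _ hY).prodMk ((measurable_pi_lambda _ hQ).prodMk hX))

lemma Action.measurable_of_coords {f : α → Action R N}
    (hdur : ∀ j, Measurable fun x => (f x).dur j) (hpow : ∀ j, Measurable fun x => (f x).pow j)
    (hadm : ∀ i, Measurable fun x => (f x).adm i) : Measurable f :=
  measurable_comap_iff.2 ((measurable_pi_lambda _ hdur).prodMk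
    ((measurable_pi_lambda _ hpow).prodMk (measurable_pi_lambda _ hadm)))

lemma IsPolicy.measurable {Ω : Type*} [mΩ : MeasurableSpace Ω] {ℱ : Filtration ℕ mΩ}
    {π : ℕ → Ω → Action R N} (hπ : IsPolicy ℱ π) (k : ℕ) : Measurable[ℱ k] (π k) :=
  Action.measurable_of_coords (hπ.dur k) (hπ.pow k) (hπ.adm k)

end MeasurableSpaces

section MeasurableStep

variable {R N α : Type*} {mα : MeasurableSpace α} {u : α → State R N} {s : α → Slot R N}
  {d : α → Action R N}

@[fun_prop]
lemma measurable_rate (hs : Measurable s) (hd : Measurable d) (j : R ⊕ N) :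
    Measurable fun x => rate (s x) (d x) j := by
  unfold rate
  fun_prop

@[fun_prop]
lemma measurable_served (hd : Measurable d) (i : R) : Measurable fun x => served (d x) i :=
  Measurable.ite (measurableSet_eq_fun (by fun_prop) measurable_const).compl
    measurable_const measurable_const

variable [Fintype R] [Fintype N]

@[fun_prop]
lemma measurable_slotPower (p : Params R) (hd : Measurable d) :
    Measurable fun x => slotPower p (d x) := by
  unfold slotPower
  fun_prop

lemma step_Y (p : Params R) (u : State R N) (s : Slot R N) (d : Action R N) (i : R) :
    (step p u s d).Y i = max (u.Y i + ind (s.1 (Sum.inl i)) * p.q i - served d i) 0 :=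
  rfl

lemma measurable_step (p : Params R) (hu : Measurable u) (hs : Measurable s) (hd : Measurable d) :
    Measurable fun x => step p (u x) (s x) (d x) := by
  refine State.measurable_of_coords (fun i => ?_) (fun i => ?_) ?_
  · simp only [step_Y]
    fun_prop
  · simp only [step]
    fun_prop
  · simp only [step]
    fun_prop

end MeasurableStep

section MeasurablePowers

variable {R N α : Type*} [MeasurableSpace α] (p : Params R) {X ψ : α → ℝ}

@[fun_prop]
lemma measurable_lambertPower (hX : Measurable X) (hψ : Measurable ψ) :
    Measurable fun x => lambertPower p (X x) (ψ x) := by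
  have hz : Measurable fun x => p.T * ψ x / X x - 1 := by fun_prop
  have hW : Measurable fun x => lambertW0 ((p.T * ψ x / X x - 1) / Real.exp 1) :=
    measurable_lambertW0.comp (hz.div_const _)
  unfold lambertPower
  exact Measurable.ite (measurableSet_eq_fun hX measurable_const)
    (Measurable.ite (measurableSet_eq_fun hψ measurable_const) measurable_const measurable_const)
    (((Measurable.ite (measurableSet_eq_fun hz measurable_const) measurable_const
      (hz.div hW)).sub_const _).min measurable_const)

@[fun_prop]
lemma measurable_rtPower (hX : Measurable X) (hψ : Measurable ψ) (n : ℕ) :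
    Measurable fun x => rtPower p (X x) (ψ x) n := by
  have hpower := measurable_lambertPower p hX hψ
  have htime : Measurable fun x => n * (p.L / Real.log (1 + lambertPower p (X x) (ψ x))) := by
    fun_prop
  unfold rtPower
  exact Measurable.ite
    ((measurableSet_lt measurable_const hpower).inter (measurableSet_le htime measurable_const))
    hpower measurable_const

@[fun_prop]
lemma measurable_rtDur (hX : Measurable X) (hψ : Measurable ψ) (n : ℕ) :
    Measurable fun x => rtDur p (X x) (ψ x) n := by
  unfold rtDur
  fun_prop

@[fun_prop]
lemma measurable_nrtPower (s : Slot R N) (i : N) :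
    Measurable fun u : State R N => nrtPower p u s i := by
  unfold nrtPower
  exact Measurable.ite (MeasurableSet.const _) measurable_const <|
    Measurable.ite (measurableSet_eq_fun (by fun_prop) measurable_const)
      (Measurable.ite (measurableSet_eq_fun (by fun_prop) measurable_const)
        measurable_const measurable_const) (by fun_prop)

@[fun_prop]
lemma measurable_psiNR (s : Slot R N) (i : N) :
    Measurable fun u : State R N => psiNR p u s i := by
  unfold psiNR
  fun_prop

lemma measurable_psiAux {ψ : State R N → ℝ} (hψ : Measurable ψ) (S : Finset R) :
    Measurable fun u : State R N => psiAux p u (ψ u) S := by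
  unfold psiAux
  fun_prop

end MeasurablePowers

section MeasurableChoices

variable {R N : Type*} (p : Params R) (s : Slot R N)

lemma measurable_isLongest [Countable N] (i : N) :
    Measurable fun u : State R N => IsLongest u s i :=
  (measurable_const.and <| Measurable.forall fun _ => measurable_const.imp <|
    measurableSet_setOfPred.1 (measurableSet_le (by fun_prop) (by fun_prop))).or measurable_const

lemma measurable_isCandidate [Countable R] {ψ : State R N → ℝ} (hψ : Measurable ψ)
    (S : Finset R) : Measurable fun u : State R N => IsCandidate p u s (ψ u) S := by
  have hiff : ∀ u : State R N, IsCandidate p u s (ψ u) S ↔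
      (∀ i ∈ S, s.1 (Sum.inl i) = true ∧ s.2 (Sum.inl i) = true) ∧
      (∀ i j, i ∈ S ∧ j ∉ S ∧ s.1 (Sum.inl j) = true ∧ s.2 (Sum.inl j) = true → u.Y j ≤ u.Y i) ∧
      rtPower p u.X (ψ u) S.card ≤ p.Pmax := fun u =>
    ⟨fun h => ⟨h.eligible, fun i j hij => h.largest i hij.1 j hij.2.1 hij.2.2.1 hij.2.2.2,
      h.pow_le⟩, fun h => ⟨h.1, fun i hi j hj harr hon => h.2.1 i j ⟨hi, hj, harr, hon⟩, h.2.2⟩⟩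
  simp only [hiff]
  refine measurable_const.and (Measurable.and ?_ ?_)
  · exact Measurable.forall fun i => Measurable.forall fun j => measurable_const.imp <|
      measurableSet_setOfPred.1 (measurableSet_le (by fun_prop) (by fun_prop))
  · exact measurableSet_setOfPred.1 (measurableSet_le (by fun_prop) measurable_const)

lemma measurable_isChoice [Countable R] [Countable N] (c : N × Finset R) :
    Measurable fun u : State R N => IsChoice p u s c := by
  have hψ := measurable_psiNR p s c.1
  have hiff : ∀ u : State R N, IsChoice p u s c ↔ IsLongest u s c.1 ∧
      IsCandidate p u s (psiNR p u s c.1) c.2 ∧ ∀ S, IsCandidate p u s (psiNR p u s c.1) S →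
        psiAux p u (psiNR p u s c.1) S ≤ psiAux p u (psiNR p u s c.1) c.2 := fun u =>
    ⟨fun h => ⟨h.longest, h.candidate, h.best⟩, fun h => ⟨h.1, h.2.1, h.2.2⟩⟩
  simp only [hiff]
  exact (measurable_isLongest s c.1).and <| (measurable_isCandidate p s hψ c.2).and <|
    Measurable.forall fun S => (measurable_isCandidate p s hψ S).imp <|
      measurableSet_setOfPred.1 <|
        measurableSet_le (measurable_psiAux p hψ S) (measurable_psiAux p hψ c.2)

lemma measurable_choiceAction (B : ℝ) (c : N × Finset R) :
    Measurable fun u => choiceAction p B u s c := by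
  refine Action.measurable_of_coords (fun j => ?_) (fun j => ?_) fun i => ?_
  · rcases j with i | i <;>
      exact Measurable.ite (MeasurableSet.const _) (by fun_prop) measurable_const
  · rcases j with i | i <;>
      exact Measurable.ite (MeasurableSet.const _) (by fun_prop) measurable_const
  · exact Measurable.ite (measurableSet_lt (by fun_prop) measurable_const) measurable_const
      measurable_const

lemma exists_measurable_selection {α ι : Type*} [MeasurableSpace α] [Countable ι] [Nonempty ι]
    [MeasurableSpace ι] {r : ι → α → Prop} (hr : ∀ i, Measurable (r i)) :
    ∃ g : α → ι, Measurable g ∧ ∀ x, (∃ i, r i x) → r (g x) x := by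
  classical
  obtain ⟨e, he⟩ := exists_surjective_nat ι
  have hex : ∀ x, ∃ n, r (e n) x ∨ ∀ i, ¬ r i x := fun x => by
    by_cases h : ∃ i, r i x
    · obtain ⟨i, hi⟩ := h
      obtain ⟨n, rfl⟩ := he i
      exact ⟨n, Or.inl hi⟩
    · exact ⟨0, Or.inr (not_exists.1 h)⟩
  have hmeas : ∀ n, MeasurableSet {x | r (e n) x ∨ ∀ i, ¬ r i x} := fun n =>
    ((hr _).or (Measurable.forall fun i => (hr i).not)).setOf
  refine ⟨fun x => e (Nat.find (hex x)), (measurable_from_nat (f := e)).comp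
    (measurable_find hex hmeas), fun x ⟨i, hi⟩ => ?_⟩
  exact (Nat.find_spec (hex x)).resolve_right fun h => h i hi

variable [Finite R] [Finite N] [Nonempty N]

lemma exists_measurable_isAlgDecision (B : ℝ) :
    ∃ D : State R N × Slot R N → Action R N, Measurable D ∧
      ∀ u s, u.Nonneg → IsAlgDecision p B u s (D (u, s)) := by
  let _ : MeasurableSpace (N × Finset R) := ⊤
  choose g hg hchoice using fun s : Slot R N => exists_measurable_selection
    (r := fun c u => IsChoice p u s c) (measurable_isChoice p s)
  refine ⟨fun x => choiceAction p B x.1 x.2 (g x.2 x.1), ?_, fun u s hu =>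
    isAlgDecision_iff.2 ⟨g s u, hchoice s u (exists_isChoice hu s), rfl⟩⟩
  refine measurable_from_prod_countable_left fun s => ?_
  have hpair : Measurable fun x : (N × Finset R) × State R N => choiceAction p B x.2 s x.1 :=
    measurable_from_prod_countable_right fun c => measurable_choiceAction p s B c
  exact hpair.comp ((hg s).prodMk measurable_id)

end MeasurableChoices

section Trajectories

variable {R N Ω : Type*} [Fintype R] [Fintype N] (p : Params R)

lemma step_nonneg (u : State R N) (s : Slot R N) (d : Action R N) : (step p u s d).Nonneg :=
  ⟨fun _ => le_max_right _ _, fun _ => le_max_right _ _, le_max_right _ _⟩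

variable {u₀ : State R N} {obs : ℕ → Ω → Slot R N}

lemma queues_nonneg (hu₀ : u₀.Nonneg) (obs : ℕ → Ω → Slot R N) (π : ℕ → Ω → Action R N) (k : ℕ)
    (ω : Ω) : (queues p u₀ obs π k ω).Nonneg := by
  cases k with
  | zero => exact hu₀
  | succ k => exact step_nonneg p _ _ _

/-- The queues that evolve under the decision rule `D`, which maps the current queues and the
current observation to a decision. -/
noncomputable def ruleQueues (u₀ : State R N) (obs : ℕ → Ω → Slot R N)
    (D : State R N × Slot R N → Action R N) : ℕ → Ω → State R N
  | 0, _ => u₀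
  | k + 1, ω => step p (ruleQueues u₀ obs D k ω) (obs k ω) (D (ruleQueues u₀ obs D k ω, obs k ω))

lemma queues_rule (u₀ : State R N) (obs : ℕ → Ω → Slot R N)
    (D : State R N × Slot R N → Action R N) (k : ℕ) (ω : Ω) :
    queues p u₀ obs (fun k ω => D (ruleQueues p u₀ obs D k ω, obs k ω)) k ω =
      ruleQueues p u₀ obs D k ω := by
  induction k with
  | zero => rfl
  | succ k ih => simp only [queues, ruleQueues, ih]

variable [mΩ : MeasurableSpace Ω] {ℱ : Filtration ℕ mΩ}

lemma measurable_queues_succ (u₀ : State R N) (hobs : ∀ k, Measurable[ℱ k] (obs k))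
    {π : ℕ → Ω → Action R N} (hπ : IsPolicy ℱ π) (k : ℕ) :
    Measurable[ℱ k] (queues p u₀ obs π (k + 1)) := by
  induction k with
  | zero => exact measurable_step p measurable_const (hobs 0) (hπ.measurable 0)
  | succ k ih =>
    exact measurable_step p (ih.mono (ℱ.mono k.le_succ) le_rfl) (hobs (k + 1))
      (hπ.measurable (k + 1))

lemma measurable_ruleQueues (u₀ : State R N) (hobs : ∀ k, Measurable[ℱ k] (obs k))
    {D : State R N × Slot R N → Action R N} (hD : Measurable D) (k : ℕ) :
    Measurable[ℱ k] (ruleQueues p u₀ obs D k) := by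
  induction k with
  | zero => exact measurable_const
  | succ k ih =>
    exact (measurable_step p ih (hobs k) (hD.comp (ih.prodMk (hobs k)))).mono
      (ℱ.mono k.le_succ) le_rfl

theorem exists_isAlgorithm [Nonempty N] (B : ℝ) (hu₀ : u₀.Nonneg)
    (hobs : ∀ k, Measurable[ℱ k] (obs k)) : ∃ π, IsAlgorithm ℱ p B u₀ obs π := by
  obtain ⟨D, hD, hdec⟩ := exists_measurable_isAlgDecision (N := N) p B
  have hmeas : ∀ k, Measurable[ℱ k] fun ω => D (ruleQueues p u₀ obs D k ω, obs k ω) :=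
    fun k => hD.comp ((measurable_ruleQueues p u₀ hobs hD k).prodMk (hobs k))
  refine ⟨fun k ω => D (ruleQueues p u₀ obs D k ω, obs k ω),
    ⟨fun k j => (Action.measurable_dur j).comp (hmeas k),
      fun k j => (Action.measurable_pow j).comp (hmeas k),
      fun k i => (Action.measurable_adm i).comp (hmeas k)⟩, fun k ω => ?_⟩
  have hnonneg := queues_nonneg p hu₀ obs
    (fun k ω => D (ruleQueues p u₀ obs D k ω, obs k ω)) k ω
  rw [queues_rule] at hnonneg ⊢
  exact hdec _ _ hnonneg

end Trajectories

section Decoupling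

variable {Ω Ω' S ι : Type*} {mΩ : MeasurableSpace Ω} {mΩ' : MeasurableSpace Ω'} {μ : Measure Ω}
  {ν : Measure Ω'} {U : ι → Ω → ℝ} {W : ι → Ω' → ℝ} {V : Ω' → ℝ} {G : Ω → ℝ}

lemma sum_integral_mul_integral_add_le [Fintype ι] [IsFiniteMeasure μ] [IsFiniteMeasure ν]
    (hU : ∀ c, Integrable (U c) μ) (hW : ∀ c, Integrable (W c) ν) (hV : Integrable V ν)
    (hG : Integrable G μ) (h : ∀ᵐ ω ∂μ, ∀ᵐ ω' ∂ν, ∑ c, U c ω * W c ω' + V ω' ≤ G ω) :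
    ∑ c, (∫ ω, U c ω ∂μ) * (∫ ω', W c ω' ∂ν) + μ.real Set.univ * ∫ ω', V ω' ∂ν ≤
      ν.real Set.univ * ∫ ω, G ω ∂μ := by
  have hinner : ∀ᵐ ω ∂μ,
      ∑ c, U c ω * (∫ ω', W c ω' ∂ν) + ∫ ω', V ω' ∂ν ≤ ν.real Set.univ * G ω := by
    filter_upwards [h] with ω hω
    have hWω : ∀ c, Integrable (fun ω' => U c ω * W c ω') ν := fun c => (hW c).const_mul _
    calc ∑ c, U c ω * (∫ ω', W c ω' ∂ν) + ∫ ω', V ω' ∂ν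
        = ∫ ω', (∑ c, U c ω * W c ω' + V ω') ∂ν := by
          rw [integral_add (integrable_finsetSum _ fun c _ => hWω c) hV,
            integral_finsetSum _ fun c _ => hWω c]
          simp_rw [integral_const_mul]
      _ ≤ ∫ _ω', G ω ∂ν := integral_mono_ae
          ((integrable_finsetSum _ fun c _ => hWω c).add hV) (integrable_const _) hω
      _ = ν.real Set.univ * G ω := by rw [integral_const, smul_eq_mul]
  have hUW : ∀ c, Integrable (fun ω => U c ω * ∫ ω', W c ω' ∂ν) μ := fun c => (hU c).mul_const _
  calc ∑ c, (∫ ω, U c ω ∂μ) * (∫ ω', W c ω' ∂ν) + μ.real Set.univ * ∫ ω', V ω' ∂ν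
      = ∫ ω, (∑ c, U c ω * (∫ ω', W c ω' ∂ν) + ∫ ω', V ω' ∂ν) ∂μ := by
        rw [integral_add (integrable_finsetSum _ fun c _ => hUW c) (integrable_const _),
          integral_finsetSum _ fun c _ => hUW c, integral_const, smul_eq_mul]
        simp_rw [integral_mul_const]
    _ ≤ ∫ ω, ν.real Set.univ * G ω ∂μ := integral_mono_ae
        ((integrable_finsetSum _ fun c _ => hUW c).add (integrable_const _)) (hG.const_mul _) hinner
    _ = ν.real Set.univ * ∫ ω, G ω ∂μ := integral_const_mul _ _

variable [MeasurableSpace S] {Z : Ω → S} {Z' : Ω' → S} {s : S}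

lemma setIntegral_preimage_of_indepFun {f : Ω → ℝ} (hZ : Measurable Z) (hf : AEMeasurable f μ)
    (h : IndepFun Z f μ) {A : Set S} (hA : MeasurableSet A) :
    ∫ ω in Z ⁻¹' A, f ω ∂μ = μ.real (Z ⁻¹' A) * ∫ ω, f ω ∂μ :=
  Indep.setIntegral_eq_mul (f := id) hZ.comap_le ((IndepFun_iff_Indep _ _ _).1 h) hf ⟨A, hA, rfl⟩
    measurable_id.aestronglyMeasurable

variable [MeasurableSingletonClass S]

lemma sum_setIntegral_fiber [Fintype S] {f : Ω → ℝ} (hZ : Measurable Z) (hf : Integrable f μ) :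
    ∑ s, ∫ ω in Z ⁻¹' {s}, f ω ∂μ = ∫ ω, f ω ∂μ := by
  rw [← integral_iUnion_fintype (fun s => hZ (measurableSet_singleton s))
    (fun s t hst => Disjoint.preimage _ (Set.disjoint_singleton.2 hst))
    (fun s => hf.integrableOn), ← Set.preimage_iUnion, Set.iUnion_of_singleton,
    Set.preimage_univ, setIntegral_univ]

variable [Fintype ι] [IsFiniteMeasure μ] [IsFiniteMeasure ν]

lemma sum_integral_mul_setIntegral_fiber_add_le (hZ : Measurable Z) (hZ' : Measurable Z')
    (hlaw : IdentDistrib Z Z' μ ν) (hU : ∀ c, Integrable (U c) μ)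
    (hW : ∀ c, Integrable (W c) ν) (hV : Integrable V ν) (hG : Integrable G μ)
    (hind : ∀ c, IndepFun Z (U c) μ)
    (h : ∀ ω ω', Z ω = Z' ω' → ∑ c, U c ω * W c ω' + V ω' ≤ G ω) (s : S) :
    ∑ c, (∫ ω, U c ω ∂μ) * (∫ ω' in Z' ⁻¹' {s}, W c ω' ∂ν) + ∫ ω' in Z' ⁻¹' {s}, V ω' ∂ν ≤
      ∫ ω in Z ⁻¹' {s}, G ω ∂μ := by
  have hs := measurableSet_singleton s
  have hprob : ν.real (Z' ⁻¹' {s}) = μ.real (Z ⁻¹' {s}) := by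
    simp only [Measure.real, hlaw.measure_preimage_eq hs]
  have hfiber := sum_integral_mul_integral_add_le (μ := μ.restrict (Z ⁻¹' {s}))
    (ν := ν.restrict (Z' ⁻¹' {s})) (fun c => (hU c).integrableOn) (fun c => (hW c).integrableOn)
    hV.integrableOn hG.integrableOn <| by
      filter_upwards [ae_restrict_mem (hZ hs)] with ω hω
      filter_upwards [ae_restrict_mem (hZ' hs)] with ω' hω'
      exact h ω ω' (hω.trans hω'.symm)
  simp only [measureReal_restrict_apply_univ, hprob,
    fun c => setIntegral_preimage_of_indepFun hZ (hU c).aemeasurable (hind c) hs, mul_assoc,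
    ← Finset.mul_sum, ← mul_add] at hfiber
  rcases (measureReal_nonneg (μ := μ) (s := Z ⁻¹' {s})).eq_or_lt with hnull | hpos
  · have hnullZ := (measureReal_eq_zero_iff (measure_ne_top _ _)).1 hnull.symm
    have hnullZ' := (measureReal_eq_zero_iff (measure_ne_top _ _)).1 (hprob.trans hnull.symm)
    simp only [Measure.restrict_eq_zero.2 hnullZ, Measure.restrict_eq_zero.2 hnullZ',
      integral_zero_measure, mul_zero, Finset.sum_const_zero, add_zero, le_refl]
  · exact le_of_mul_le_mul_left hfiber hpos

/-- The decoupling step: `U` is independent of `Z`, and the bound is only known at pairs of points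
with the same observation; in expectation `U` may nevertheless be replaced by its mean. -/
lemma sum_integral_mul_integral_add_le_of_identDistrib [Finite S] (hZ : Measurable Z)
    (hZ' : Measurable Z') (hlaw : IdentDistrib Z Z' μ ν) (hU : ∀ c, Integrable (U c) μ)
    (hW : ∀ c, Integrable (W c) ν) (hV : Integrable V ν) (hG : Integrable G μ)
    (hind : ∀ c, IndepFun Z (U c) μ)
    (h : ∀ ω ω', Z ω = Z' ω' → ∑ c, U c ω * W c ω' + V ω' ≤ G ω) :
    ∑ c, (∫ ω, U c ω ∂μ) * (∫ ω', W c ω' ∂ν) + ∫ ω', V ω' ∂ν ≤ ∫ ω, G ω ∂μ := by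
  have := Fintype.ofFinite S
  have hsum := Finset.sum_le_sum fun s (_ : s ∈ Finset.univ) =>
    sum_integral_mul_setIntegral_fiber_add_le hZ hZ' hlaw hU hW hV hG hind h s
  rw [Finset.sum_add_distrib, Finset.sum_comm, sum_setIntegral_fiber hZ' hV,
    sum_setIntegral_fiber hZ hG] at hsum
  simpa only [← Finset.mul_sum, sum_setIntegral_fiber hZ' (hW _)] using hsum

end Decoupling

section TimeAverages

lemma timeAvg_mono {f g : ℕ → ℝ} (h : ∀ k, f k ≤ g k) (K : ℕ) : timeAvg f K ≤ timeAvg g K :=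
  div_le_div_of_nonneg_right (Finset.sum_le_sum fun k _ => h k) K.cast_nonneg

lemma timeAvg_const (x : ℝ) {K : ℕ} (hK : K ≠ 0) : timeAvg (fun _ => x) K = x := by
  simp [timeAvg, hK]

lemma timeAvg_add (f g : ℕ → ℝ) (K : ℕ) :
    timeAvg (fun k => f k + g k) K = timeAvg f K + timeAvg g K := by
  simp [timeAvg, Finset.sum_add_distrib, add_div]

lemma timeAvg_sub (f g : ℕ → ℝ) (K : ℕ) :
    timeAvg (fun k => f k - g k) K = timeAvg f K - timeAvg g K := by
  simp [timeAvg, Finset.sum_sub_distrib, sub_div]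

lemma timeAvg_const_mul (x : ℝ) (f : ℕ → ℝ) (K : ℕ) :
    timeAvg (fun k => x * f k) K = x * timeAvg f K := by
  simp [timeAvg, ← Finset.mul_sum, mul_div_assoc]

lemma timeAvg_mul_const (f : ℕ → ℝ) (x : ℝ) (K : ℕ) :
    timeAvg (fun k => f k * x) K = timeAvg f K * x := by
  simp [timeAvg, ← Finset.sum_mul, div_mul_eq_mul_div]

lemma timeAvg_sum {ι : Type*} (s : Finset ι) (f : ι → ℕ → ℝ) (K : ℕ) :
    timeAvg (fun k => ∑ c ∈ s, f c k) K = ∑ c ∈ s, timeAvg (f c) K := by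
  simp only [timeAvg]
  rw [Finset.sum_comm, Finset.sum_div]

lemma timeAvg_sub_succ (l : ℕ → ℝ) (K : ℕ) :
    timeAvg (fun k => l k - l (k + 1)) K = (l 0 - l K) / K := by
  rw [timeAvg, Finset.sum_range_sub']

lemma tendsto_timeAvg_const (x : ℝ) : Tendsto (timeAvg fun _ => x) atTop (𝓝 x) :=
  tendsto_const_nhds.congr' ((eventually_ne_atTop 0).mono fun _ hK => (timeAvg_const x hK).symm)

lemma eventually_neg_le_const_div (C : ℝ) {ε : ℝ} (hε : 0 < ε) :
    ∀ᶠ K : ℕ in atTop, -ε ≤ C / K :=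
  (tendsto_const_div_atTop_nhds_zero_nat C).eventually_const_le (neg_lt_zero.2 hε)

variable {f g l : ℕ → ℝ} {a b x : ℝ}

lemma eventually_timeAvg_mem_Icc (h : ∀ k, f k ∈ Set.Icc a b) :
    ∀ᶠ K in atTop, timeAvg f K ∈ Set.Icc a b := by
  filter_upwards [eventually_ne_atTop 0] with K hK
  exact ⟨(timeAvg_const a hK).ge.trans (timeAvg_mono (fun k => (h k).1) K),
    (timeAvg_mono (fun k => (h k).2) K).trans (timeAvg_const b hK).le⟩

lemma le_liminf_timeAvg_iff (h : ∀ k, f k ∈ Set.Icc a b) :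
    x ≤ liminf (timeAvg f) atTop ↔ ∀ ε > 0, ∀ᶠ K in atTop, x - ε ≤ timeAvg f K := by
  have hmem := eventually_timeAvg_mem_Icc h
  constructor
  · intro hx ε hε
    exact (eventually_lt_of_lt_liminf ((sub_lt_self x hε).trans_le hx)
      (isBoundedUnder_of_eventually_ge (hmem.mono fun _ hK => hK.1))).mono fun _ hK => hK.le
  · intro hx
    exact le_of_forall_sub_le fun ε hε => le_liminf_of_le
      (isBoundedUnder_of_eventually_le (hmem.mono fun _ hK => hK.2)).isCoboundedUnder_ge (hx ε hε)

lemma limsup_timeAvg_le_iff (h : ∀ k, f k ∈ Set.Icc a b) :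
    limsup (timeAvg f) atTop ≤ x ↔ ∀ ε > 0, ∀ᶠ K in atTop, timeAvg f K ≤ x + ε := by
  have hmem := eventually_timeAvg_mem_Icc h
  constructor
  · intro hx ε hε
    exact (eventually_lt_of_limsup_lt (hx.trans_lt (lt_add_of_pos_right x hε))
      (isBoundedUnder_of_eventually_le (hmem.mono fun _ hK => hK.2))).mono fun _ hK => hK.le
  · intro hx
    exact le_of_forall_pos_le_add fun ε hε => limsup_le_of_le
      (isBoundedUnder_of_eventually_ge (hmem.mono fun _ hK => hK.1)).isCoboundedUnder_le (hx ε hε)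

lemma tendsto_timeAvg_sub_succ (hl : Tendsto (fun k : ℕ => l k / k) atTop (𝓝 0)) :
    Tendsto (timeAvg fun k => l k - l (k + 1)) atTop (𝓝 0) := by
  have hlim := (tendsto_const_div_atTop_nhds_zero_nat (l 0)).sub hl
  rw [sub_zero] at hlim
  exact hlim.congr fun K => by rw [timeAvg_sub_succ, sub_div]

lemma le_liminf_timeAvg_of_tendsto (hf : ∀ k, f k ∈ Set.Icc a b)
    (hg : Tendsto (timeAvg g) atTop (𝓝 x)) (hl : Tendsto (fun k : ℕ => l k / k) atTop (𝓝 0))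
    (h : ∀ k, l k - l (k + 1) ≤ f k - g k) : x ≤ liminf (timeAvg f) atTop := by
  refine (le_liminf_timeAvg_iff hf).2 fun ε hε => ?_
  have hlim := (tendsto_timeAvg_sub_succ hl).add hg
  rw [zero_add] at hlim
  filter_upwards [hlim.eventually_const_le (sub_lt_self x hε)] with K hK
  have hmono := timeAvg_mono h K
  rw [timeAvg_sub f g] at hmono
  linarith

lemma limsup_timeAvg_le_of_tendsto (hf : ∀ k, f k ∈ Set.Icc a b)
    (hl : Tendsto (fun k : ℕ => l k / k) atTop (𝓝 0))
    (h : ∀ k, l k - l (k + 1) ≤ x - f k) : limsup (timeAvg f) atTop ≤ x := by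
  refine (limsup_timeAvg_le_iff hf).2 fun ε hε => ?_
  filter_upwards [(tendsto_timeAvg_sub_succ hl).eventually_const_le (neg_lt_zero.2 hε),
    eventually_ne_atTop 0] with K hK hK0
  have hmono := timeAvg_mono h K
  rw [timeAvg_sub _ f, timeAvg_const x hK0] at hmono
  linarith

end TimeAverages

section RateStability

lemma le_add_nat_mul_of_succ_le {l : ℕ → ℝ} {M : ℝ} (h : ∀ k, l (k + 1) ≤ l k + M) (k : ℕ) :
    l k ≤ l 0 + k * M := by
  induction k with
  | zero => simp
  | succ k ih =>
    push_cast
    linarith [h k]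

/-- The sequence `k * M - l k` is monotone, so its growth rate can be read off along the squares. -/
lemma tendsto_div_of_tendsto_sq_div {l : ℕ → ℝ} {M x : ℝ} (hinc : ∀ k, l (k + 1) ≤ l k + M)
    (hsq : Tendsto (fun n : ℕ => l (n ^ 2) / (n : ℝ) ^ 2) atTop (𝓝 x)) :
    Tendsto (fun k : ℕ => l k / k) atTop (𝓝 x) := by
  have hmono : Monotone fun k : ℕ => k * M - l k := monotone_nat_of_le_succ fun k => by
    push_cast
    linarith [hinc k]
  have hsquares : Tendsto (fun n : ℕ => ((n ^ 2 : ℕ) * M - l (n ^ 2)) / (n ^ 2 : ℕ)) atTop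
      (𝓝 (M - x)) := by
    refine (tendsto_const_nhds.sub hsq).congr' ?_
    filter_upwards [eventually_ne_atTop 0] with n hn
    push_cast
    field_simp
  have hratio : ∀ a : ℝ, 1 < a →
      ∀ᶠ n : ℕ in atTop, (((n + 1) ^ 2 : ℕ) : ℝ) ≤ a * (n ^ 2 : ℕ) := fun a ha => by
    have hlim : Tendsto (fun n : ℕ => (1 + 1 / (n : ℝ)) ^ 2) atTop (𝓝 1) := by
      simpa using (tendsto_one_div_atTop_nhds_zero_nat.const_add (1 : ℝ)).pow 2
    filter_upwards [hlim.eventually_le_const ha, eventually_ne_atTop 0] with n hn hn0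
    calc (((n + 1) ^ 2 : ℕ) : ℝ) = (1 + 1 / (n : ℝ)) ^ 2 * (n ^ 2 : ℕ) := by
          push_cast
          field_simp
      _ ≤ a * (n ^ 2 : ℕ) := by gcongr
  have hlim := tendsto_div_of_monotone_of_exists_subseq_tendsto_div _ (M - x) hmono fun a ha =>
    ⟨fun n => n ^ 2, hratio a ha, tendsto_pow_atTop two_ne_zero, hsquares⟩
  have hlim' := (tendsto_const_nhds (x := M)).sub hlim
  rw [sub_sub_cancel] at hlim'
  refine hlim'.congr' ?_
  filter_upwards [eventually_ne_atTop 0] with n hn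
  field_simp
  ring

variable {Ω : Type*} [MeasurableSpace Ω] {μ : Measure Ω}

lemma ae_tendsto_zero_of_summable_integral {f : ℕ → Ω → ℝ} (hint : ∀ n, Integrable (f n) μ)
    (hnonneg : ∀ n ω, 0 ≤ f n ω) (hsum : Summable fun n => ∫ ω, f n ω ∂μ) :
    ∀ᵐ ω ∂μ, Tendsto (fun n => f n ω) atTop (𝓝 0) := by
  have hmeas : ∀ n, AEMeasurable (fun ω => ENNReal.ofReal (f n ω)) μ := fun n =>
    (hint n).aemeasurable.ennreal_ofReal
  have hfinite : ∫⁻ ω, ∑' n, ENNReal.ofReal (f n ω) ∂μ ≠ ⊤ := by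
    simp only [lintegral_tsum hmeas,
      ← ofReal_integral_eq_lintegral_ofReal (hint _) (ae_of_all _ (hnonneg _))]
    exact hsum.tsum_ofReal_ne_top
  filter_upwards [ae_lt_top' (AEMeasurable.tsum hmeas) hfinite] with ω hω
  have hlim := (ENNReal.tendsto_toReal ENNReal.zero_ne_top).comp
    (ENNReal.tendsto_atTop_zero_of_tsum_ne_top hω.ne)
  exact hlim.congr fun n => ENNReal.toReal_ofReal (hnonneg n ω)

/-- By Chebyshev's argument `l (n ^ 2) / n ^ 2` is almost surely square summable; the bounded
increments then control `l` between consecutive squares. -/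
lemma ae_tendsto_div_zero {l : ℕ → Ω → ℝ} {M a b : ℝ} (hinc : ∀ k ω, l (k + 1) ω ≤ l k ω + M)
    (hint : ∀ k, Integrable (fun ω => l k ω ^ 2) μ)
    (hsq : ∀ k : ℕ, ∫ ω, l k ω ^ 2 ∂μ ≤ a + b * k) :
    ∀ᵐ ω ∂μ, Tendsto (fun k : ℕ => l k ω / k) atTop (𝓝 0) := by
  have hmoment : ∀ n : ℕ, ∫ ω, (l (n ^ 2) ω / (n : ℝ) ^ 2) ^ 2 ∂μ ≤
      a * (1 / (n : ℝ) ^ 4) + b * (1 / (n : ℝ) ^ 2) := fun n => by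
    rcases eq_or_ne n 0 with rfl | hn
    · simp
    · simp only [div_pow]
      rw [integral_div, div_le_iff₀ (by positivity)]
      refine (hsq (n ^ 2)).trans_eq ?_
      push_cast
      field_simp
  have hsum : Summable fun n : ℕ => ∫ ω, (l (n ^ 2) ω / (n : ℝ) ^ 2) ^ 2 ∂μ :=
    .of_nonneg_of_le (fun n => integral_nonneg fun ω => sq_nonneg _) hmoment <|
      ((Real.summable_one_div_nat_pow.2 (by norm_num)).mul_left a).add
        ((Real.summable_one_div_nat_pow.2 one_lt_two).mul_left b)
  have hae := ae_tendsto_zero_of_summable_integral (μ := μ)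
    (fun n => by simpa only [div_pow] using (hint _).div_const _) (fun _ _ => sq_nonneg _) hsum
  filter_upwards [hae] with ω hω
  refine tendsto_div_of_tendsto_sq_div (hinc · ω) ((tendsto_zero_iff_abs_tendsto_zero _).2 ?_)
  simpa only [Function.comp_def, Real.sqrt_zero, Real.sqrt_sq_eq_abs]
    using (Real.continuous_sqrt.tendsto 0).comp hω

lemma tendsto_integral_div_zero [IsFiniteMeasure μ] {l : ℕ → Ω → ℝ} {M C : ℝ}
    (hl : ∀ k, Measurable (l k)) (hnonneg : ∀ k ω, 0 ≤ l k ω)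
    (hle : ∀ (k : ℕ) ω, l k ω ≤ C + k * M)
    (h : ∀ᵐ ω ∂μ, Tendsto (fun k : ℕ => l k ω / k) atTop (𝓝 0)) :
    Tendsto (fun k : ℕ => (∫ ω, l k ω ∂μ) / k) atTop (𝓝 0) := by
  have hbound : ∀ (k : ℕ) ω, ‖l k ω / k‖ ≤ |C| + |M| := fun k ω => by
    rw [Real.norm_of_nonneg (div_nonneg (hnonneg k ω) k.cast_nonneg)]
    rcases Nat.eq_zero_or_pos k with rfl | hk
    · simpa using add_nonneg (abs_nonneg C) (abs_nonneg M)
    · have hk' : (1 : ℝ) ≤ k := by exact_mod_cast hk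
      rw [div_le_iff₀ (by linarith)]
      nlinarith [hle k ω, le_abs_self C, le_abs_self M, abs_nonneg C]
  have hlim := tendsto_integral_of_dominated_convergence (μ := μ) (F := fun k ω => l k ω / k)
    (fun _ => |C| + |M|) (fun k => ((hl k).div_const _).aestronglyMeasurable)
    (integrable_const _) (fun k => ae_of_all _ (hbound k)) h
  simpa only [integral_div, integral_zero] using hlim

end RateStability

section Drift

/-- Names of all queues of the system: `Sum.inl (Sum.inl i)` stands for `Y i`,
`Sum.inl (Sum.inr i)` for `Q i`, and `Sum.inr ()` for `X`. -/
abbrev QueueIndex (R N : Type*) := (R ⊕ N) ⊕ Unit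

variable {R N : Type*}

/-- All queues as one vector, so that the three kinds of queues share their drift estimates. -/
def levels (u : State R N) : QueueIndex R N → ℝ
  | Sum.inl (Sum.inl i) => u.Y i
  | Sum.inl (Sum.inr i) => u.Q i
  | Sum.inr _ => u.X

lemma levels_nonneg {u : State R N} (hu : u.Nonneg) (c : QueueIndex R N) : 0 ≤ levels u c := by
  rcases c with (i | i) | _
  exacts [hu.1 i, hu.2.1 i, hu.2.2]

lemma measurable_levels (c : QueueIndex R N) : Measurable fun u : State R N => levels u c := by
  rcases c with (i | i) | _
  exacts [State.measurable_Y i, State.measurable_Q i, State.measurable_X]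

lemma sub_sq_le_sq_add_sq {x y a b : ℝ} (hx : x ∈ Set.Icc 0 a) (hy : y ∈ Set.Icc 0 b) :
    (x - y) ^ 2 ≤ a ^ 2 + b ^ 2 := by
  have hxa : x ^ 2 ≤ a ^ 2 := pow_le_pow_left₀ hx.1 hx.2 2
  have hyb : y ^ 2 ≤ b ^ 2 := pow_le_pow_left₀ hy.1 hy.2 2
  nlinarith only [hxa, hyb, mul_nonneg hx.1 hy.1]

lemma max_zero_sq_le_sq (x : ℝ) : max x 0 ^ 2 ≤ x ^ 2 := by
  rw [sq_le_sq, abs_of_nonneg (le_max_right x 0)]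
  exact max_le (le_abs_self x) (abs_nonneg x)

variable [Fintype R] [Fintype N]

lemma sum_queueIndex (f : QueueIndex R N → ℝ) :
    ∑ c, f c = ∑ i, f (Sum.inl (Sum.inl i)) + ∑ i, f (Sum.inl (Sum.inr i)) + f (Sum.inr ()) := by
  rw [Fintype.sum_sum_type, Fintype.sum_sum_type, Fintype.sum_unique (ι := Unit)]

/-- Service minus arrivals of each queue in one slot. -/
noncomputable def surplus (p : Params R) (s : Slot R N) (d : Action R N) : QueueIndex R N → ℝ
  | Sum.inl (Sum.inl i) => served d i - ind (s.1 (Sum.inl i)) * p.q i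
  | Sum.inl (Sum.inr i) => d.dur (Sum.inr i) * rate s d (Sum.inr i) - p.L * ind (d.adm i)
  | Sum.inr _ => p.Pavg - slotPower p d

/-- The quadratic Lyapunov function of the queues. -/
noncomputable def lyapunov (u : State R N) : ℝ := (∑ c, levels u c ^ 2) / 2

variable {p : Params R} {u : State R N} {s : Slot R N} {d : Action R N}

lemma levels_step (c : QueueIndex R N) :
    levels (step p u s d) c = max (levels u c - surplus p s d c) 0 := by
  rcases c with (i | i) | _ <;> simp only [levels, surplus, step, served, sub_sub_eq_add_sub]

lemma lyapunov_nonneg (u : State R N) : 0 ≤ lyapunov u :=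
  div_nonneg (Finset.sum_nonneg fun _ _ => sq_nonneg _) zero_le_two

lemma levels_sq_le_two_mul_lyapunov (u : State R N) (c : QueueIndex R N) :
    levels u c ^ 2 ≤ 2 * lyapunov u := by
  rw [lyapunov, mul_div_cancel₀ _ two_ne_zero]
  exact Finset.single_le_sum (f := fun c => levels u c ^ 2) (fun _ _ => sq_nonneg _)
    (Finset.mem_univ c)

namespace Action.Valid

lemma slotPower_mem_Icc (hd : d.Valid p s) : slotPower p d ∈ Set.Icc 0 p.Pmax := by
  refine ⟨div_nonneg (Finset.sum_nonneg fun j _ =>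
    mul_nonneg (hd.pow_mem j).1 (hd.dur_mem j).1) p.T_pos.le, ?_⟩
  rw [slotPower, div_le_iff₀ p.T_pos, ← hd.sum_dur, Finset.mul_sum]
  exact Finset.sum_le_sum fun j _ =>
    mul_le_mul_of_nonneg_right (hd.pow_mem j).2 (hd.dur_mem j).1

lemma dur_mul_rate_mem_Icc (hd : d.Valid p s) (j : R ⊕ N) :
    d.dur j * rate s d j ∈ Set.Icc 0 (p.T * Real.log (1 + p.Pmax)) :=
  ⟨mul_nonneg (hd.dur_mem j).1 (hd.rate_nonneg j),
    mul_le_mul (hd.dur_mem j).2 (hd.rate_le j) (hd.rate_nonneg j) p.T_pos.le⟩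

end Action.Valid

lemma surplus_delivery_sq_le (p : Params R) (s : Slot R N) (d : Action R N) (i : R) :
    surplus p s d (Sum.inl (Sum.inl i)) ^ 2 ≤ p.q i ^ 2 + 1 := by
  have h := sub_sq_le_sq_add_sq (served_mem_Icc d i)
    (y := ind (s.1 (Sum.inl i)) * p.q i) (b := p.q i)
    ⟨mul_nonneg (ind_nonneg _) (p.q_nonneg i),
      mul_le_of_le_one_left (p.q_nonneg i) (ind_le_one _)⟩
  rwa [one_pow, add_comm] at h

namespace Action.Valid

lemma surplus_data_sq_le (hd : d.Valid p s) (i : N) :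
    surplus p s d (Sum.inl (Sum.inr i)) ^ 2 ≤
      p.L ^ 2 + p.T ^ 2 * Real.log (1 + p.Pmax) ^ 2 := by
  have h := sub_sq_le_sq_add_sq (hd.dur_mul_rate_mem_Icc (Sum.inr i))
    (y := p.L * ind (d.adm i)) (b := p.L)
    ⟨mul_nonneg p.L_pos.le (ind_nonneg _), mul_le_of_le_one_right p.L_pos.le (ind_le_one _)⟩
  rwa [mul_pow, add_comm] at h

lemma surplus_power_sq_le (hd : d.Valid p s) :
    surplus p s d (Sum.inr ()) ^ 2 ≤ p.Pmax ^ 2 + p.Pavg ^ 2 := by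
  have h := sub_sq_le_sq_add_sq (Set.right_mem_Icc.2 p.Pavg_nonneg) hd.slotPower_mem_Icc
  rwa [add_comm] at h

lemma sum_surplus_sq_le (hd : d.Valid p s) : ∑ c, surplus p s d c ^ 2 ≤ 2 * C1 p N := by
  have hdelivery := Finset.sum_le_sum fun i (_ : i ∈ Finset.univ) => surplus_delivery_sq_le p s d i
  have hdata := Finset.sum_le_sum fun i (_ : i ∈ Finset.univ) => hd.surplus_data_sq_le i
  rw [Finset.sum_const, nsmul_eq_mul, Finset.card_univ] at hdata
  rw [sum_queueIndex, C1]
  linarith [hd.surplus_power_sq_le]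

lemma abs_surplus_le (hd : d.Valid p s) (c : QueueIndex R N) :
    |surplus p s d c| ≤ √(2 * C1 p N) :=
  Real.abs_le_sqrt <| (Finset.single_le_sum (f := fun c => surplus p s d c ^ 2)
    (fun _ _ => sq_nonneg _) (Finset.mem_univ c)).trans hd.sum_surplus_sq_le

lemma lyapunov_step_le (hd : d.Valid p s) (u : State R N) :
    lyapunov (step p u s d) ≤ lyapunov u + C1 p N - ∑ c, levels u c * surplus p s d c := by
  have hqueue : ∀ c, levels (step p u s d) c ^ 2 ≤
      levels u c ^ 2 - 2 * (levels u c * surplus p s d c) + surplus p s d c ^ 2 := fun c => by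
    rw [levels_step, ← mul_assoc, ← sub_sq]
    exact max_zero_sq_le_sq _
  have hsum := Finset.sum_le_sum fun c (_ : c ∈ Finset.univ) => hqueue c
  rw [Finset.sum_add_distrib, Finset.sum_sub_distrib, ← Finset.mul_sum] at hsum
  unfold lyapunov
  linarith [hd.sum_surplus_sq_le]

end Action.Valid

section MeasurableSurplus

variable {α : Type*} [MeasurableSpace α]

lemma measurable_surplus (p : Params R) {s : α → Slot R N} {d : α → Action R N}
    (hs : Measurable s) (hd : Measurable d) (c : QueueIndex R N) :
    Measurable fun x => surplus p (s x) (d x) c := by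
  rcases c with (i | i) | _ <;> simp only [surplus] <;> fun_prop

end MeasurableSurplus

end Drift

section Admission

variable {R N : Type*} [Fintype N]

/-- The number of packets admitted in one slot. -/
noncomputable def admitted (d : Action R N) : ℝ := ∑ i, ind (d.adm i)

lemma admitted_mem_Icc (d : Action R N) : admitted d ∈ Set.Icc (0 : ℝ) (Fintype.card N) := by
  refine ⟨Finset.sum_nonneg fun i _ => ind_nonneg _, ?_⟩
  calc admitted d ≤ ∑ _i : N, (1 : ℝ) := Finset.sum_le_sum fun i _ => ind_le_one _
    _ = Fintype.card N := by rw [Finset.sum_const, nsmul_one, Finset.card_univ]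

lemma measurable_admitted : Measurable fun d : Action R N => admitted d := by
  unfold admitted
  fun_prop

variable [Fintype R] {p : Params R} {u : State R N} {s : Slot R N} {d d' : Action R N}

lemma sum_levels_mul_surplus_add_admitted (B : ℝ) :
    ∑ c, levels u c * surplus p s d c + B * p.L * admitted d =
      gain p B u s d + (u.X * p.Pavg - ∑ i, u.Y i * (ind (s.1 (Sum.inl i)) * p.q i)) := by
  rw [sum_queueIndex]
  simp only [levels, surplus, gain, admitted, mul_sub, sub_mul, Finset.sum_sub_distrib,
    Finset.mul_sum, mul_assoc, mul_left_comm B]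
  ring

/-- Among all valid decisions, the algorithm minimizes the bound of `lyapunov_step_le` on the drift
minus the reward `B L` per admitted packet. -/
lemma IsAlgDecision.sum_levels_mul_surplus_add_admitted_le {B : ℝ} (h : IsAlgDecision p B u s d)
    (hu : u.Nonneg) (hd' : d'.Valid p s) :
    ∑ c, levels u c * surplus p s d' c + B * p.L * admitted d' ≤
      ∑ c, levels u c * surplus p s d c + B * p.L * admitted d := by
  rw [sum_levels_mul_surplus_add_admitted, sum_levels_mul_surplus_add_admitted]
  exact add_le_add_left (h.gain_le hu hd') _

end Admission

section SamplePath

variable {R N Ω : Type*} [Fintype R] [Fintype N] {u₀ : State R N}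

lemma levels_queues_nonneg (p : Params R) (hu₀ : u₀.Nonneg) (obs : ℕ → Ω → Slot R N)
    (π : ℕ → Ω → Action R N) (k : ℕ) (ω : Ω) (c : QueueIndex R N) :
    0 ≤ levels (queues p u₀ obs π k ω) c :=
  levels_nonneg (queues_nonneg p hu₀ obs π k ω) c

lemma levels_queues_sub_succ_le (p : Params R) (u₀ : State R N) (obs : ℕ → Ω → Slot R N)
    (π : ℕ → Ω → Action R N) (k : ℕ) (ω : Ω) (c : QueueIndex R N) :
    levels (queues p u₀ obs π k ω) c - levels (queues p u₀ obs π (k + 1) ω) c ≤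
      surplus p (obs k ω) (π k ω) c := by
  rw [queues, levels_step, sub_le_comm]
  exact le_max_left _ _

end SamplePath

section Information

variable {Ω : Type*} [mΩ : MeasurableSpace Ω] {μ : Measure Ω}

lemma integral_mem_Icc [IsProbabilityMeasure μ] {f : Ω → ℝ} {a b : ℝ} (hf : AEMeasurable f μ)
    (h : ∀ ω, f ω ∈ Set.Icc a b) : ∫ ω, f ω ∂μ ∈ Set.Icc a b :=
  (convex_Icc a b).integral_mem isClosed_Icc (ae_of_all _ h) (.of_mem_Icc a b hf (ae_of_all _ h))

variable {R N : Type*} {ℱ : Filtration ℕ mΩ} {lam : R → ℝ}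
  {obs : ℕ → Ω → Slot R N}

namespace IsOnOffModel

lemma indepFun_obs_succ {β : Type*} [MeasurableSpace β] (hobs : IsOnOffModel μ ℱ obs lam) {k : ℕ}
    {f : Ω → β} (hf : Measurable[ℱ k] f) : IndepFun (obs (k + 1)) f μ :=
  (IndepFun_iff_Indep _ _ _).2 (indep_of_indep_of_le_right (hobs.indep k) hf.comap_le)

lemma measurable_obs (hobs : IsOnOffModel μ ℱ obs lam) (k : ℕ) : Measurable (obs k) :=
  (hobs.measurable k).mono (ℱ.le k) le_rfl

lemma integral_arrival (hobs : IsOnOffModel μ ℱ obs lam) (k : ℕ) (i : R) :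
    ∫ ω, ind ((obs k ω).1 (Sum.inl i)) ∂μ = lam i := by
  have hm : Measurable fun s : Slot R N => ind (s.1 (Sum.inl i)) := by fun_prop
  have hset : MeasurableSet {ω | (obs 0 ω).1 (Sum.inl i) = true} :=
    ((measurable_pi_apply (Sum.inl i)).comp (hobs.measurable_obs 0).fst)
      (measurableSet_singleton true)
  calc ∫ ω, ind ((obs k ω).1 (Sum.inl i)) ∂μ = ∫ ω, ind ((obs 0 ω).1 (Sum.inl i)) ∂μ :=
        ((hobs.identDistrib k).comp hm).integral_eq
    _ = ∫ ω, {ω | (obs 0 ω).1 (Sum.inl i) = true}.indicator 1 ω ∂μ := by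
        simp only [ind, Set.indicator_apply, Set.mem_ofPred_eq, Pi.one_apply]
    _ = lam i := by rw [integral_indicator_one hset, hobs.arrival i]

lemma integrable_arrival [IsProbabilityMeasure μ] (hobs : IsOnOffModel μ ℱ obs lam) (k : ℕ)
    (i : R) : Integrable (fun ω => ind ((obs k ω).1 (Sum.inl i))) μ := by
  have := hobs.measurable_obs k
  exact .of_mem_Icc 0 1 (by fun_prop) (ae_of_all _ fun _ => ⟨ind_nonneg _, ind_le_one _⟩)

lemma ae_tendsto_timeAvg_arrival [IsProbabilityMeasure μ] (hobs : IsOnOffModel μ ℱ obs lam)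
    (i : R) :
    ∀ᵐ ω ∂μ, Tendsto (timeAvg fun k => ind ((obs k ω).1 (Sum.inl i))) atTop (𝓝 (lam i)) := by
  have hm : Measurable fun s : Slot R N => ind (s.1 (Sum.inl i)) := by fun_prop
  have hlt : ∀ j k, j < k → IndepFun (obs k) (obs j) μ := fun j k hjk => by
    obtain ⟨k, rfl⟩ := Nat.exists_eq_succ_of_ne_zero (Nat.ne_zero_of_lt hjk)
    exact hobs.indepFun_obs_succ
      ((hobs.measurable j).mono (ℱ.mono (Nat.lt_succ_iff.1 hjk)) le_rfl)
  have hpair : Pairwise fun j k => IndepFun (obs j) (obs k) μ := fun j k hjk =>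
    hjk.lt_or_gt.elim (fun h => (hlt j k h).symm) (hlt k j)
  have hlaw := strong_law_ae_real (μ := μ) (fun k ω => ind ((obs k ω).1 (Sum.inl i)))
    (hobs.integrable_arrival 0 i) (fun j k hjk => (hpair hjk).comp hm hm)
    (fun k => (hobs.identDistrib k).comp hm)
  rwa [hobs.integral_arrival] at hlaw

variable [Fintype R] [Fintype N]

lemma indepFun_obs_queues [IsProbabilityMeasure μ] (hobs : IsOnOffModel μ ℱ obs lam)
    (p : Params R) (u₀ : State R N) {π : ℕ → Ω → Action R N} (hπ : IsPolicy ℱ π) (k : ℕ) :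
    IndepFun (obs k) (queues p u₀ obs π k) μ := by
  cases k with
  | zero => exact indepFun_const_right _ u₀
  | succ k => exact hobs.indepFun_obs_succ (measurable_queues_succ p u₀ hobs.measurable hπ k)

end IsOnOffModel

end Information

section SlotwiseFeasible

variable {R N Ω : Type*} [Fintype R] [Fintype N] [mΩ : MeasurableSpace Ω] {μ : Measure Ω}
  {ℱ : Filtration ℕ mΩ} {p : Params R} {B : ℝ} {lam : R → ℝ} {obs : ℕ → Ω → Slot R N}
  {u₀ : State R N} {π : ℕ → Ω → Action R N}

/-- Slot-based algorithms that satisfy the per-slot constraints, for observations that are known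
at the beginning of their slot. Neither an i.i.d. assumption nor a long-term constraint is part of
this notion, so it covers both Algorithm 1 and its feasible competitors. -/
structure IsSlotwiseFeasible (ℱ : Filtration ℕ mΩ) (p : Params R) (obs : ℕ → Ω → Slot R N)
    (π : ℕ → Ω → Action R N) : Prop where
  measurable_obs : ∀ k, Measurable[ℱ k] (obs k)
  policy : IsPolicy ℱ π
  valid : ∀ k ω, (π k ω).Valid p (obs k ω)

lemma IsFeasible.isSlotwiseFeasible (h : IsFeasible μ ℱ p lam u₀ obs π)
    (hobs : ∀ k, Measurable[ℱ k] (obs k)) : IsSlotwiseFeasible ℱ p obs π :=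
  ⟨hobs, h.policy, h.valid⟩

lemma IsAlgorithm.isSlotwiseFeasible (h : IsAlgorithm ℱ p B u₀ obs π)
    (hobs : ∀ k, Measurable[ℱ k] (obs k)) : IsSlotwiseFeasible ℱ p obs π :=
  ⟨hobs, h.policy, fun k ω => (h.decision k ω).valid⟩

namespace IsSlotwiseFeasible

lemma measurable_action (hπ : IsSlotwiseFeasible ℱ p obs π) (k : ℕ) : Measurable (π k) :=
  (hπ.policy.measurable k).mono (ℱ.le k) le_rfl

lemma measurable_queues (hπ : IsSlotwiseFeasible ℱ p obs π) (u₀ : State R N) (k : ℕ) :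
    Measurable (queues p u₀ obs π k) := by
  cases k with
  | zero => exact measurable_const
  | succ k =>
    exact (measurable_queues_succ p u₀ hπ.measurable_obs hπ.policy k).mono (ℱ.le k) le_rfl

lemma measurable_levels (hπ : IsSlotwiseFeasible ℱ p obs π) (u₀ : State R N) (k : ℕ)
    (c : QueueIndex R N) : Measurable fun ω => levels (queues p u₀ obs π k ω) c :=
  (RTNRT.measurable_levels c).comp (hπ.measurable_queues u₀ k)

lemma measurable_surplus (hπ : IsSlotwiseFeasible ℱ p obs π) (k : ℕ) (c : QueueIndex R N) :
    Measurable fun ω => surplus p (obs k ω) (π k ω) c :=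
  RTNRT.measurable_surplus p ((hπ.measurable_obs k).mono (ℱ.le k) le_rfl)
    (hπ.measurable_action k) c

lemma levels_succ_le (hπ : IsSlotwiseFeasible ℱ p obs π) (hu₀ : u₀.Nonneg) (k : ℕ) (ω : Ω)
    (c : QueueIndex R N) :
    levels (queues p u₀ obs π (k + 1) ω) c ≤
      levels (queues p u₀ obs π k ω) c + √(2 * C1 p N) := by
  have hsurplus := neg_le_of_abs_le ((hπ.valid k ω).abs_surplus_le c)
  have hlevel := levels_queues_nonneg p hu₀ obs π k ω c
  rw [queues, levels_step]
  exact max_le (by linarith) (by positivity)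

lemma levels_le (hπ : IsSlotwiseFeasible ℱ p obs π) (hu₀ : u₀.Nonneg) (k : ℕ) (ω : Ω)
    (c : QueueIndex R N) :
    levels (queues p u₀ obs π k ω) c ≤ levels u₀ c + k * √(2 * C1 p N) :=
  le_add_nat_mul_of_succ_le (l := fun k => levels (queues p u₀ obs π k ω) c)
    (hπ.levels_succ_le hu₀ · ω c) k

section Integrability

variable [IsFiniteMeasure μ]

lemma integrable_levels (hπ : IsSlotwiseFeasible ℱ p obs π) (hu₀ : u₀.Nonneg) (k : ℕ)
    (c : QueueIndex R N) : Integrable (fun ω => levels (queues p u₀ obs π k ω) c) μ :=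
  .of_mem_Icc _ _ (hπ.measurable_levels u₀ k c).aemeasurable <| ae_of_all _ fun ω =>
    ⟨levels_queues_nonneg p hu₀ obs π k ω c, hπ.levels_le hu₀ k ω c⟩

lemma integrable_levels_sq (hπ : IsSlotwiseFeasible ℱ p obs π) (hu₀ : u₀.Nonneg) (k : ℕ)
    (c : QueueIndex R N) : Integrable (fun ω => levels (queues p u₀ obs π k ω) c ^ 2) μ :=
  .of_mem_Icc _ _ ((hπ.measurable_levels u₀ k c).pow_const 2).aemeasurable <| ae_of_all _ fun ω =>
    ⟨sq_nonneg _, pow_le_pow_left₀ (levels_queues_nonneg p hu₀ obs π k ω c)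
      (hπ.levels_le hu₀ k ω c) 2⟩

lemma integrable_lyapunov (hπ : IsSlotwiseFeasible ℱ p obs π) (hu₀ : u₀.Nonneg) (k : ℕ) :
    Integrable (fun ω => lyapunov (queues p u₀ obs π k ω)) μ :=
  (integrable_finsetSum _ fun c _ => hπ.integrable_levels_sq hu₀ k c).div_const 2

lemma integrable_surplus (hπ : IsSlotwiseFeasible ℱ p obs π) (k : ℕ) (c : QueueIndex R N) :
    Integrable (fun ω => surplus p (obs k ω) (π k ω) c) μ :=
  .of_mem_Icc _ _ (hπ.measurable_surplus k c).aemeasurable <| ae_of_all _ fun ω =>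
    abs_le.1 ((hπ.valid k ω).abs_surplus_le c)

lemma integrable_levels_mul_surplus (hπ : IsSlotwiseFeasible ℱ p obs π) (hu₀ : u₀.Nonneg) (k : ℕ)
    (c : QueueIndex R N) :
    Integrable (fun ω => levels (queues p u₀ obs π k ω) c * surplus p (obs k ω) (π k ω) c) μ :=
  (hπ.integrable_levels hu₀ k c).mul_bdd (hπ.measurable_surplus k c).aestronglyMeasurable
    (ae_of_all _ fun ω => (hπ.valid k ω).abs_surplus_le c)

lemma integrable_served (hπ : IsSlotwiseFeasible ℱ p obs π) (k : ℕ) (i : R) :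
    Integrable (fun ω => served (π k ω) i) μ :=
  .of_mem_Icc 0 1 (measurable_served (hπ.measurable_action k) i).aemeasurable
    (ae_of_all _ fun _ => served_mem_Icc _ i)

lemma integrable_slotPower (hπ : IsSlotwiseFeasible ℱ p obs π) (k : ℕ) :
    Integrable (fun ω => slotPower p (π k ω)) μ :=
  .of_mem_Icc _ _ (measurable_slotPower p (hπ.measurable_action k)).aemeasurable
    (ae_of_all _ fun ω => (hπ.valid k ω).slotPower_mem_Icc)

lemma integrable_admitted (hπ : IsSlotwiseFeasible ℱ p obs π) (k : ℕ) :
    Integrable (fun ω => admitted (π k ω)) μ :=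
  .of_mem_Icc _ _ (measurable_admitted.comp (hπ.measurable_action k)).aemeasurable
    (ae_of_all _ fun _ => admitted_mem_Icc _)

lemma integral_levels_sub_succ_le (hπ : IsSlotwiseFeasible ℱ p obs π) (hu₀ : u₀.Nonneg) (k : ℕ)
    (c : QueueIndex R N) :
    ∫ ω, levels (queues p u₀ obs π k ω) c ∂μ - ∫ ω, levels (queues p u₀ obs π (k + 1) ω) c ∂μ ≤
      ∫ ω, surplus p (obs k ω) (π k ω) c ∂μ := by
  have hnow := hπ.integrable_levels (μ := μ) hu₀ k c
  have hnext := hπ.integrable_levels (μ := μ) hu₀ (k + 1) c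
  rw [← integral_sub hnow hnext]
  exact integral_mono (hnow.sub hnext) (hπ.integrable_surplus k c)
    fun ω => levels_queues_sub_succ_le p u₀ obs π k ω c

end Integrability

variable [IsProbabilityMeasure μ]

lemma integral_lyapunov_succ_le (hπ : IsSlotwiseFeasible ℱ p obs π) (hu₀ : u₀.Nonneg) (k : ℕ) :
    ∫ ω, lyapunov (queues p u₀ obs π (k + 1) ω) ∂μ ≤
      ∫ ω, lyapunov (queues p u₀ obs π k ω) ∂μ + C1 p N
        - ∫ ω, ∑ c, levels (queues p u₀ obs π k ω) c * surplus p (obs k ω) (π k ω) c ∂μ := by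
  have hlyap := hπ.integrable_lyapunov (μ := μ) hu₀ k
  have hsum := integrable_finsetSum Finset.univ fun c _ =>
    hπ.integrable_levels_mul_surplus (μ := μ) hu₀ k c
  have hdrift := integral_mono (hπ.integrable_lyapunov (μ := μ) hu₀ (k + 1))
    ((hlyap.add (integrable_const (C1 p N))).sub hsum)
    fun ω => (hπ.valid k ω).lyapunov_step_le (queues p u₀ obs π k ω)
  rw [integral_sub' (hlyap.add (integrable_const _)) hsum, integral_add' hlyap (integrable_const _),
    integral_const, probReal_univ, one_smul] at hdrift
  exact hdrift

end IsSlotwiseFeasible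

end SlotwiseFeasible

section DriftComparison

variable {R N Ω : Type*} [Fintype R] [Fintype N] [mΩ : MeasurableSpace Ω] {μ : Measure Ω}
  [IsProbabilityMeasure μ] {ℱ : Filtration ℕ mΩ} {p : Params R} {lam : R → ℝ} {B : ℝ}
  {obs : ℕ → Ω → Slot R N} {u₀ : State R N} {π π' : ℕ → Ω → Action R N}

namespace IsAlgorithm

lemma sum_integral_levels_mul_integral_surplus_le (h : IsAlgorithm ℱ p B u₀ obs π)
    (hobs : IsOnOffModel μ ℱ obs lam) (hu₀ : u₀.Nonneg) (hπ' : IsSlotwiseFeasible ℱ p obs π')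
    (k j : ℕ) :
    ∑ c, (∫ ω, levels (queues p u₀ obs π k ω) c ∂μ) * (∫ ω, surplus p (obs j ω) (π' j ω) c ∂μ)
        + B * p.L * ∫ ω, admitted (π' j ω) ∂μ ≤
      ∫ ω, ∑ c, levels (queues p u₀ obs π k ω) c * surplus p (obs k ω) (π k ω) c ∂μ
        + B * p.L * ∫ ω, admitted (π k ω) ∂μ := by
  have hπ := h.isSlotwiseFeasible hobs.measurable
  have hsum := integrable_finsetSum Finset.univ fun c _ =>
    hπ.integrable_levels_mul_surplus (μ := μ) hu₀ k c
  have hadm := (hπ.integrable_admitted (μ := μ) k).const_mul (B * p.L)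
  rw [← integral_const_mul, ← integral_const_mul, ← integral_add hsum hadm]
  refine sum_integral_mul_integral_add_le_of_identDistrib (hobs.measurable_obs k)
    (hobs.measurable_obs j) ((hobs.identDistrib k).trans (hobs.identDistrib j).symm)
    (hπ.integrable_levels hu₀ k) (hπ'.integrable_surplus j)
    ((hπ'.integrable_admitted j).const_mul _) (hsum.add hadm)
    (fun c => (hobs.indepFun_obs_queues p u₀ h.policy k).comp measurable_id
      (RTNRT.measurable_levels c)) fun ω ω' hω => ?_
  rw [← hω]
  exact (h.decision k ω).sum_levels_mul_surplus_add_admitted_le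
    (queues_nonneg p hu₀ obs π k ω) (hω ▸ hπ'.valid j ω')

lemma integral_lyapunov_succ_add_le (h : IsAlgorithm ℱ p B u₀ obs π)
    (hobs : IsOnOffModel μ ℱ obs lam) (hu₀ : u₀.Nonneg) (hπ' : IsSlotwiseFeasible ℱ p obs π')
    (k j : ℕ) :
    ∫ ω, lyapunov (queues p u₀ obs π (k + 1) ω) ∂μ
        + (∑ c, (∫ ω, levels (queues p u₀ obs π k ω) c ∂μ)
            * (∫ ω, surplus p (obs j ω) (π' j ω) c ∂μ)
          + B * p.L * ∫ ω, admitted (π' j ω) ∂μ) ≤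
      ∫ ω, lyapunov (queues p u₀ obs π k ω) ∂μ + C1 p N
        + B * p.L * ∫ ω, admitted (π k ω) ∂μ := by
  linarith [h.sum_integral_levels_mul_integral_surplus_le hobs hu₀ hπ' k j,
    (h.isSlotwiseFeasible hobs.measurable).integral_lyapunov_succ_le (μ := μ) hu₀ k]

lemma integral_lyapunov_succ_add_timeAvg_le (h : IsAlgorithm ℱ p B u₀ obs π)
    (hobs : IsOnOffModel μ ℱ obs lam) (hu₀ : u₀.Nonneg) (hπ' : IsSlotwiseFeasible ℱ p obs π')
    (k : ℕ) {J : ℕ} (hJ : J ≠ 0) :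
    ∫ ω, lyapunov (queues p u₀ obs π (k + 1) ω) ∂μ
        + (∑ c, (∫ ω, levels (queues p u₀ obs π k ω) c ∂μ)
            * timeAvg (fun j => ∫ ω, surplus p (obs j ω) (π' j ω) c ∂μ) J
          + B * p.L * timeAvg (fun j => ∫ ω, admitted (π' j ω) ∂μ) J) ≤
      ∫ ω, lyapunov (queues p u₀ obs π k ω) ∂μ + C1 p N
        + B * p.L * ∫ ω, admitted (π k ω) ∂μ := by
  have havg := timeAvg_mono (h.integral_lyapunov_succ_add_le hobs hu₀ hπ' k) J
  simpa only [timeAvg_add, timeAvg_const _ hJ, timeAvg_sum, timeAvg_const_mul] using havg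

end IsAlgorithm

end DriftComparison

section Backlog

variable {R N : Type*}

/-- The queued NRT data, in packets. -/
noncomputable def backlog [Fintype N] (p : Params R) (u : State R N) : ℝ := (∑ i, u.Q i) / p.L

lemma backlog_nonneg [Fintype N] (p : Params R) {u : State R N} (hu : u.Nonneg) :
    0 ≤ backlog p u :=
  div_nonneg (Finset.sum_nonneg fun i _ => hu.2.1 i) p.L_pos.le

variable [Fintype R] [Fintype N] {p : Params R} {u : State R N} {s : Slot R N} {d : Action R N}

lemma bits_inr_eq (p : Params R) (u : State R N) (s : Slot R N) (d : Action R N) (i : N) :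
    bits p u s d (Sum.inr i) = u.Q i - (step p u s d).Q i + p.L * ind (d.adm i) := by
  have hflow := max_sub_sub_left (u.Q i + p.L * ind (d.adm i))
    (d.dur (Sum.inr i) * rate s d (Sum.inr i)) (u.Q i + p.L * ind (d.adm i))
  rw [sub_self] at hflow
  simp only [bits, step, hflow]
  ring

lemma sum_bits_inr_div (p : Params R) (u : State R N) (s : Slot R N) (d : Action R N) :
    ∑ i : N, bits p u s d (Sum.inr i) / p.L =
      backlog p u - backlog p (step p u s d) + admitted d := by
  simp only [bits_inr_eq, add_div, sub_div, mul_div_cancel_left₀ _ p.L_pos.ne', backlog, admitted,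
    Finset.sum_add_distrib, Finset.sum_sub_distrib, Finset.sum_div]

lemma Action.Valid.bits_inr_mem_Icc (hd : d.Valid p s) (hu : u.Nonneg) (i : N) :
    bits p u s d (Sum.inr i) ∈ Set.Icc 0 (p.T * Real.log (1 + p.Pmax)) :=
  ⟨le_min (hd.dur_mul_rate_mem_Icc (Sum.inr i)).1
    (add_nonneg (hu.2.1 i) (mul_nonneg p.L_pos.le (ind_nonneg _))),
    (min_le_left _ _).trans (hd.dur_mul_rate_mem_Icc (Sum.inr i)).2⟩

lemma Action.Valid.bits_inl_div (hd : d.Valid p s) (u : State R N) (i : R) :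
    bits p u s d (Sum.inl i) / p.L = served d i := by
  rw [bits, hd.dur_mul_rate_inl, mul_div_cancel_left₀ _ p.L_pos.ne']

end Backlog

section LongRun

variable {R N Ω : Type*} [Fintype R] [Fintype N] [mΩ : MeasurableSpace Ω] {μ : Measure Ω}
  {ℱ : Filtration ℕ mΩ} {p : Params R} {lam : R → ℝ} {obs : ℕ → Ω → Slot R N}
  {u₀ : State R N} {π : ℕ → Ω → Action R N}

namespace IsSlotwiseFeasible

lemma packets_inl (hπ : IsSlotwiseFeasible ℱ p obs π) (u₀ : State R N) (i : R) (k : ℕ) (ω : Ω) :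
    packets p u₀ obs π (Sum.inl i) k ω = served (π k ω) i :=
  (hπ.valid k ω).bits_inl_div _ i

lemma packets_inr_mem_Icc (hπ : IsSlotwiseFeasible ℱ p obs π) (hu₀ : u₀.Nonneg) (i : N) (k : ℕ)
    (ω : Ω) :
    packets p u₀ obs π (Sum.inr i) k ω ∈ Set.Icc 0 (p.T * Real.log (1 + p.Pmax) / p.L) := by
  have hbits := (hπ.valid k ω).bits_inr_mem_Icc (queues_nonneg p hu₀ obs π k ω) i
  exact ⟨div_nonneg hbits.1 p.L_pos.le, div_le_div_of_nonneg_right hbits.2 p.L_pos.le⟩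

lemma measurable_packets_inr (hπ : IsSlotwiseFeasible ℱ p obs π) (u₀ : State R N) (i : N)
    (k : ℕ) : Measurable (packets p u₀ obs π (Sum.inr i) k) := by
  have hqueues := hπ.measurable_queues u₀ k
  have hobs := (hπ.measurable_obs k).mono (ℱ.le k) le_rfl
  have haction := hπ.measurable_action k
  unfold packets
  simp only [bits]
  fun_prop

lemma integrable_backlog [IsFiniteMeasure μ] (hπ : IsSlotwiseFeasible ℱ p obs π)
    (hu₀ : u₀.Nonneg) (k : ℕ) : Integrable (fun ω => backlog p (queues p u₀ obs π k ω)) μ :=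
  (integrable_finsetSum _ fun i _ => hπ.integrable_levels hu₀ k (Sum.inl (Sum.inr i))).div_const _

lemma sum_integral_packets [IsFiniteMeasure μ] (hπ : IsSlotwiseFeasible ℱ p obs π)
    (hu₀ : u₀.Nonneg) (k : ℕ) :
    ∑ i : N, ∫ ω, packets p u₀ obs π (Sum.inr i) k ω ∂μ =
      ∫ ω, backlog p (queues p u₀ obs π k ω) ∂μ
        - ∫ ω, backlog p (queues p u₀ obs π (k + 1) ω) ∂μ + ∫ ω, admitted (π k ω) ∂μ := by
  have hnow := hπ.integrable_backlog (μ := μ) hu₀ k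
  have hnext := hπ.integrable_backlog (μ := μ) hu₀ (k + 1)
  rw [← integral_finsetSum _ fun i _ =>
      .of_mem_Icc _ _ (hπ.measurable_packets_inr u₀ i k).aemeasurable
        (ae_of_all _ (hπ.packets_inr_mem_Icc hu₀ i k)),
    ← integral_sub' hnow hnext, ← integral_add' (hnow.sub hnext) (hπ.integrable_admitted k)]
  exact integral_congr_ae (ae_of_all _ fun ω => sum_bits_inr_div p _ _ _)

variable [IsProbabilityMeasure μ]

lemma sum_integral_packets_mem_Icc (hπ : IsSlotwiseFeasible ℱ p obs π) (hu₀ : u₀.Nonneg) (k : ℕ) :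
    ∑ i : N, ∫ ω, packets p u₀ obs π (Sum.inr i) k ω ∂μ ∈
      Set.Icc 0 (∑ _i : N, p.T * Real.log (1 + p.Pmax) / p.L) := by
  have hmem := fun i : N => integral_mem_Icc (μ := μ)
    (hπ.measurable_packets_inr u₀ i k).aemeasurable (hπ.packets_inr_mem_Icc hu₀ i k)
  exact ⟨Finset.sum_nonneg fun i _ => (hmem i).1, Finset.sum_le_sum fun i _ => (hmem i).2⟩

lemma timeAvg_sum_integral_packets (hπ : IsSlotwiseFeasible ℱ p obs π) (hu₀ : u₀.Nonneg)
    (K : ℕ) :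
    timeAvg (fun k => ∑ i : N, ∫ ω, packets p u₀ obs π (Sum.inr i) k ω ∂μ) K =
      (backlog p u₀ - ∫ ω, backlog p (queues p u₀ obs π K ω) ∂μ) / K
        + timeAvg (fun k => ∫ ω, admitted (π k ω) ∂μ) K := by
  simp only [hπ.sum_integral_packets hu₀]
  rw [timeAvg_add, timeAvg_sub_succ fun k => ∫ ω, backlog p (queues p u₀ obs π k ω) ∂μ]
  simp only [queues, integral_const, probReal_univ, one_smul]

lemma integral_served_mem_Icc (hπ : IsSlotwiseFeasible ℱ p obs π) (i : R) (k : ℕ) :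
    ∫ ω, served (π k ω) i ∂μ ∈ Set.Icc 0 1 :=
  integral_mem_Icc (measurable_served (hπ.measurable_action k) i).aemeasurable
    fun _ => served_mem_Icc _ i

lemma integral_slotPower_mem_Icc (hπ : IsSlotwiseFeasible ℱ p obs π) (k : ℕ) :
    ∫ ω, slotPower p (π k ω) ∂μ ∈ Set.Icc 0 p.Pmax :=
  integral_mem_Icc (measurable_slotPower p (hπ.measurable_action k)).aemeasurable
    fun ω => (hπ.valid k ω).slotPower_mem_Icc

lemma integral_surplus_delivery (hπ : IsSlotwiseFeasible ℱ p obs π)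
    (hobs : IsOnOffModel μ ℱ obs lam) (i : R) (k : ℕ) :
    ∫ ω, surplus p (obs k ω) (π k ω) (Sum.inl (Sum.inl i)) ∂μ =
      ∫ ω, served (π k ω) i ∂μ - lam i * p.q i := by
  simp only [surplus]
  rw [integral_sub (hπ.integrable_served k i) ((hobs.integrable_arrival k i).mul_const _),
    integral_mul_const, hobs.integral_arrival]

lemma integral_surplus_power (hπ : IsSlotwiseFeasible ℱ p obs π) (k : ℕ) :
    ∫ ω, surplus p (obs k ω) (π k ω) (Sum.inr ()) ∂μ = p.Pavg - ∫ ω, slotPower p (π k ω) ∂μ := by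
  simp only [surplus]
  rw [integral_sub (integrable_const _) (hπ.integrable_slotPower k), integral_const,
    probReal_univ, one_smul]

end IsSlotwiseFeasible

namespace IsFeasible

variable [IsProbabilityMeasure μ] {ε : ℝ}

lemma eventually_surplus_delivery (h : IsFeasible μ ℱ p lam u₀ obs π)
    (hobs : IsOnOffModel μ ℱ obs lam) (i : R) (hε : 0 < ε) :
    ∀ᶠ K in atTop,
      -ε ≤ timeAvg (fun k => ∫ ω, surplus p (obs k ω) (π k ω) (Sum.inl (Sum.inl i)) ∂μ) K := by
  have hπ := h.isSlotwiseFeasible hobs.measurable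
  have hdelivery := h.delivery i
  simp only [hπ.packets_inl] at hdelivery
  filter_upwards [(le_liminf_timeAvg_iff (hπ.integral_served_mem_Icc i)).1 hdelivery ε hε,
    eventually_ne_atTop 0] with K hK hK0
  simp only [hπ.integral_surplus_delivery hobs]
  rw [timeAvg_sub, timeAvg_const _ hK0]
  linarith

lemma eventually_surplus_data (h : IsFeasible μ ℱ p lam u₀ obs π)
    (hobs : ∀ k, Measurable[ℱ k] (obs k)) (hu₀ : u₀.Nonneg) (i : N) (hε : 0 < ε) :
    ∀ᶠ K in atTop,
      -ε ≤ timeAvg (fun k => ∫ ω, surplus p (obs k ω) (π k ω) (Sum.inl (Sum.inr i)) ∂μ) K := by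
  obtain ⟨M, hM, -⟩ := EReal.lt_iff_exists_real_btwn.1 (h.stable i)
  let l : ℕ → ℝ := fun k => ∫ ω, levels (queues p u₀ obs π k ω) (Sum.inl (Sum.inr i)) ∂μ
  filter_upwards [eventually_lt_of_limsup_lt hM, eventually_neg_le_const_div (l 0 - M) hε]
    with K hK hconst
  have hlM : l K < M := EReal.coe_lt_coe_iff.1 hK
  calc -ε ≤ (l 0 - M) / K := hconst
    _ ≤ (l 0 - l K) / K := by gcongr
    _ = timeAvg (fun k => l k - l (k + 1)) K := (timeAvg_sub_succ l K).symm
    _ ≤ _ := timeAvg_mono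
      (fun k => (h.isSlotwiseFeasible hobs).integral_levels_sub_succ_le hu₀ k _) K

lemma eventually_surplus_power (h : IsFeasible μ ℱ p lam u₀ obs π)
    (hobs : ∀ k, Measurable[ℱ k] (obs k)) (hε : 0 < ε) :
    ∀ᶠ K in atTop,
      -ε ≤ timeAvg (fun k => ∫ ω, surplus p (obs k ω) (π k ω) (Sum.inr ()) ∂μ) K := by
  have hπ := h.isSlotwiseFeasible hobs
  filter_upwards [(limsup_timeAvg_le_iff hπ.integral_slotPower_mem_Icc).1 h.power ε hε,
    eventually_ne_atTop 0] with K hK hK0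
  simp only [hπ.integral_surplus_power]
  rw [timeAvg_sub, timeAvg_const _ hK0]
  linarith

lemma eventually_surplus (h : IsFeasible μ ℱ p lam u₀ obs π) (hobs : IsOnOffModel μ ℱ obs lam)
    (hu₀ : u₀.Nonneg) (hε : 0 < ε) (c : QueueIndex R N) :
    ∀ᶠ K in atTop, -ε ≤ timeAvg (fun k => ∫ ω, surplus p (obs k ω) (π k ω) c ∂μ) K := by
  rcases c with (i | i) | _
  · exact h.eventually_surplus_delivery hobs i hε
  · exact h.eventually_surplus_data hobs.measurable hu₀ i hε
  · exact h.eventually_surplus_power hobs.measurable hε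

lemma eventually_admitted (h : IsFeasible μ ℱ p lam u₀ obs π)
    (hobs : ∀ k, Measurable[ℱ k] (obs k)) (hu₀ : u₀.Nonneg) (hε : 0 < ε) :
    ∀ᶠ K in atTop, sumThroughput μ p u₀ obs π - ε ≤
      timeAvg (fun k => ∫ ω, admitted (π k ω) ∂μ) K := by
  have hπ := h.isSlotwiseFeasible hobs
  have hthroughput := (le_liminf_timeAvg_iff (hπ.sum_integral_packets_mem_Icc hu₀)).1
    (le_refl (sumThroughput μ p u₀ obs π))
  filter_upwards [hthroughput (ε / 2) (half_pos hε),
    eventually_neg_le_const_div (-backlog p u₀) (half_pos hε)] with K hK hconst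
  have hbacklog : 0 ≤ (∫ ω, backlog p (queues p u₀ obs π K ω) ∂μ) / K :=
    div_nonneg (integral_nonneg fun ω => backlog_nonneg p (queues_nonneg p hu₀ obs π K ω))
      K.cast_nonneg
  rw [hπ.timeAvg_sum_integral_packets hu₀, sub_div] at hK
  rw [neg_div] at hconst
  linarith

end IsFeasible

end LongRun

section Performance

variable {R N Ω : Type*} [Fintype R] [Fintype N] [mΩ : MeasurableSpace Ω] {μ : Measure Ω}
  {ℱ : Filtration ℕ mΩ} {p : Params R} {lam : R → ℝ} {B : ℝ}
  {obs : ℕ → Ω → Slot R N} {u₀ : State R N} {π π' : ℕ → Ω → Action R N}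

namespace IsAlgorithm

lemma queues_Q_le (h : IsAlgorithm ℱ p B u₀ obs π) (hu₀ : u₀.Nonneg) (i : N) (k : ℕ) (ω : Ω) :
    (queues p u₀ obs π k ω).Q i ≤ max (u₀.Q i) (B + p.L) := by
  have hnonneg := fun k => (queues_nonneg p hu₀ obs π k ω).2.1 i
  induction k with
  | zero => exact le_max_left _ _
  | succ k ih =>
    obtain ⟨-, -, -, -, -, -, -, -, -, hadm⟩ := h.decision k ω
    have hserved := ((h.decision k ω).valid.dur_mul_rate_mem_Icc (Sum.inr i)).1
    refine max_le ?_ ((hnonneg k).trans ih)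
    rw [hadm i]
    split_ifs with hlt
    · have hpacket := mul_le_of_le_one_right p.L_pos.le (ind_le_one ((obs k ω).1 (Sum.inr i)))
      exact le_max_of_le_right (by linarith)
    · rw [ind, if_neg Bool.false_ne_true, mul_zero, add_zero]
      exact (sub_le_self _ hserved).trans ih

lemma backlog_queues_le (h : IsAlgorithm ℱ p B u₀ obs π) (hu₀ : u₀.Nonneg) (k : ℕ) (ω : Ω) :
    backlog p (queues p u₀ obs π k ω) ≤ (∑ i, max (u₀.Q i) (B + p.L)) / p.L :=
  div_le_div_of_nonneg_right (Finset.sum_le_sum fun i _ => h.queues_Q_le hu₀ i k ω) p.L_pos.le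

variable [IsProbabilityMeasure μ]

lemma drift_le_of_isFeasible (h : IsAlgorithm ℱ p B u₀ obs π) (hobs : IsOnOffModel μ ℱ obs lam)
    (hu₀ : u₀.Nonneg) (hB : 0 < B) (h' : IsFeasible μ ℱ p lam u₀ obs π') (k : ℕ) :
    ∫ ω, lyapunov (queues p u₀ obs π (k + 1) ω) ∂μ + B * p.L * sumThroughput μ p u₀ obs π' ≤
      ∫ ω, lyapunov (queues p u₀ obs π k ω) ∂μ + C1 p N
        + B * p.L * ∫ ω, admitted (π k ω) ∂μ := by
  have hBL : 0 < B * p.L := mul_pos hB p.L_pos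
  let E : QueueIndex R N → ℝ := fun c => ∫ ω, levels (queues p u₀ obs π k ω) c ∂μ
  have hE : ∀ c, 0 ≤ E c := fun c =>
    integral_nonneg fun ω => levels_queues_nonneg p hu₀ obs π k ω c
  have hA : 0 < ∑ c, E c + B * p.L :=
    add_pos_of_nonneg_of_pos (Finset.sum_nonneg fun c _ => hE c) hBL
  refine le_of_forall_pos_le_add fun ε hε => ?_
  obtain ⟨δ, hδ, hδε⟩ : ∃ δ > 0, (∑ c, E c + B * p.L) * δ = ε :=
    ⟨_, div_pos hε hA, mul_div_cancel₀ _ hA.ne'⟩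
  obtain ⟨J, hsurplus, hadmitted, hJ⟩ :=
    ((eventually_all.2 (h'.eventually_surplus hobs hu₀ hδ)).and
      ((h'.eventually_admitted hobs.measurable hu₀ hδ).and (eventually_ne_atTop 0))).exists
  have hqueues := Finset.sum_le_sum fun c (_ : c ∈ Finset.univ) =>
    mul_le_mul_of_nonneg_left (hsurplus c) (hE c)
  have hreward := mul_le_mul_of_nonneg_left hadmitted hBL.le
  have hdrift := h.integral_lyapunov_succ_add_timeAvg_le hobs hu₀
    (h'.isSlotwiseFeasible hobs.measurable) k hJ
  rw [← Finset.sum_mul] at hqueues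
  linarith

lemma lyapunov_add_le (h : IsAlgorithm ℱ p B u₀ obs π) (hobs : IsOnOffModel μ ℱ obs lam)
    (hu₀ : u₀.Nonneg) (hB : 0 < B) (h' : IsFeasible μ ℱ p lam u₀ obs π') (K : ℕ) :
    ∫ ω, lyapunov (queues p u₀ obs π K ω) ∂μ + K * (B * p.L * sumThroughput μ p u₀ obs π') ≤
      lyapunov u₀ + K * C1 p N
        + B * p.L * ∑ k ∈ Finset.range K, ∫ ω, admitted (π k ω) ∂μ := by
  induction K with
  | zero => simp [queues]
  | succ K ih =>
    rw [Finset.sum_range_succ]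
    push_cast
    linarith [h.drift_le_of_isFeasible hobs hu₀ hB h' K]

lemma integral_levels_sq_le (h : IsAlgorithm ℱ p B u₀ obs π) (hobs : IsOnOffModel μ ℱ obs lam)
    (hu₀ : u₀.Nonneg) (hB : 0 < B) (h' : IsFeasible μ ℱ p lam u₀ obs π') (k : ℕ)
    (c : QueueIndex R N) :
    ∫ ω, levels (queues p u₀ obs π k ω) c ^ 2 ∂μ ≤
      2 * lyapunov u₀
        + 2 * (C1 p N + B * p.L * (Fintype.card N - sumThroughput μ p u₀ obs π')) * k := by
  have hπ := h.isSlotwiseFeasible hobs.measurable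
  have hlyap := integral_mono (hπ.integrable_levels_sq (μ := μ) hu₀ k c)
    ((hπ.integrable_lyapunov hu₀ k).const_mul 2)
    fun ω => levels_sq_le_two_mul_lyapunov (queues p u₀ obs π k ω) c
  rw [integral_const_mul] at hlyap
  have hadmitted : ∑ j ∈ Finset.range k, ∫ ω, admitted (π j ω) ∂μ ≤ k * Fintype.card N := by
    have hle := Finset.sum_le_card_nsmul (Finset.range k) (fun j => ∫ ω, admitted (π j ω) ∂μ) _
      fun j _ => (integral_mem_Icc (measurable_admitted.comp (hπ.measurable_action j)).aemeasurable
        fun _ => admitted_mem_Icc _).2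
    rwa [Finset.card_range, nsmul_eq_mul] at hle
  linarith [h.lyapunov_add_le hobs hu₀ hB h' k,
    mul_le_mul_of_nonneg_left hadmitted (mul_pos hB p.L_pos).le]

lemma ae_tendsto_levels_div (h : IsAlgorithm ℱ p B u₀ obs π) (hobs : IsOnOffModel μ ℱ obs lam)
    (hu₀ : u₀.Nonneg) (hB : 0 < B) (h' : IsFeasible μ ℱ p lam u₀ obs π') (c : QueueIndex R N) :
    ∀ᵐ ω ∂μ, Tendsto (fun k : ℕ => levels (queues p u₀ obs π k ω) c / k) atTop (𝓝 0) :=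
  have hπ := h.isSlotwiseFeasible hobs.measurable
  ae_tendsto_div_zero (hπ.levels_succ_le hu₀ · · c) (hπ.integrable_levels_sq hu₀ · c)
    (h.integral_levels_sq_le hobs hu₀ hB h' · c)

lemma tendsto_integral_levels_div (h : IsAlgorithm ℱ p B u₀ obs π)
    (hobs : IsOnOffModel μ ℱ obs lam) (hu₀ : u₀.Nonneg) (hB : 0 < B)
    (h' : IsFeasible μ ℱ p lam u₀ obs π') (c : QueueIndex R N) :
    Tendsto (fun k : ℕ => (∫ ω, levels (queues p u₀ obs π k ω) c ∂μ) / k) atTop (𝓝 0) :=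
  have hπ := h.isSlotwiseFeasible hobs.measurable
  tendsto_integral_div_zero (hπ.measurable_levels u₀ · c)
    (levels_queues_nonneg p hu₀ obs π · · c) (hπ.levels_le hu₀ · · c)
    (h.ae_tendsto_levels_div hobs hu₀ hB h' c)

lemma limsup_integral_Q_lt_top (h : IsAlgorithm ℱ p B u₀ obs π)
    (hobs : ∀ k, Measurable[ℱ k] (obs k)) (hu₀ : u₀.Nonneg) (i : N) :
    limsup (fun k => ((∫ ω, (queues p u₀ obs π k ω).Q i ∂μ : ℝ) : EReal)) atTop < ⊤ := by
  have hmem := fun k => integral_mem_Icc (μ := μ)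
    ((h.isSlotwiseFeasible hobs).measurable_levels u₀ k (Sum.inl (Sum.inr i))).aemeasurable
    fun ω => ⟨(queues_nonneg p hu₀ obs π k ω).2.1 i, h.queues_Q_le hu₀ i k ω⟩
  exact (limsup_le_of_le (h := Eventually.of_forall fun k =>
    EReal.coe_le_coe_iff.2 (hmem k).2)).trans_lt (EReal.coe_lt_top _)

lemma isFeasible (h : IsAlgorithm ℱ p B u₀ obs π) (hobs : IsOnOffModel μ ℱ obs lam)
    (hu₀ : u₀.Nonneg) (hB : 0 < B) (h' : IsFeasible μ ℱ p lam u₀ obs π') :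
    IsFeasible μ ℱ p lam u₀ obs π := by
  have hπ := h.isSlotwiseFeasible hobs.measurable
  refine ⟨h.policy, hπ.valid, h.limsup_integral_Q_lt_top hobs.measurable hu₀, fun i => ?_, ?_⟩
  · simp only [hπ.packets_inl]
    refine le_liminf_timeAvg_of_tendsto (hπ.integral_served_mem_Icc i)
      (tendsto_timeAvg_const (lam i * p.q i))
      (h.tendsto_integral_levels_div hobs hu₀ hB h' (Sum.inl (Sum.inl i))) fun k => ?_
    rw [← hπ.integral_surplus_delivery hobs]
    exact hπ.integral_levels_sub_succ_le hu₀ k _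
  · refine limsup_timeAvg_le_of_tendsto hπ.integral_slotPower_mem_Icc
      (h.tendsto_integral_levels_div hobs hu₀ hB h' (Sum.inr ())) fun k => ?_
    rw [← hπ.integral_surplus_power]
    exact hπ.integral_levels_sub_succ_le hu₀ k _

lemma ae_delivery (h : IsAlgorithm ℱ p B u₀ obs π) (hobs : IsOnOffModel μ ℱ obs lam)
    (hu₀ : u₀.Nonneg) (hB : 0 < B) (h' : IsFeasible μ ℱ p lam u₀ obs π') (i : R) :
    ∀ᵐ ω ∂μ, lam i * p.q i ≤
      liminf (timeAvg fun k => packets p u₀ obs π (Sum.inl i) k ω) atTop := by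
  filter_upwards [h.ae_tendsto_levels_div hobs hu₀ hB h' (Sum.inl (Sum.inl i)),
    hobs.ae_tendsto_timeAvg_arrival i] with ω hqueue harrival
  simp only [(h.isSlotwiseFeasible hobs.measurable).packets_inl]
  exact le_liminf_timeAvg_of_tendsto (fun k => served_mem_Icc (π k ω) i)
    (g := fun k => ind ((obs k ω).1 (Sum.inl i)) * p.q i)
    ((harrival.mul_const (p.q i)).congr fun K => (timeAvg_mul_const _ _ K).symm) hqueue
    fun k => levels_queues_sub_succ_le p u₀ obs π k ω (Sum.inl (Sum.inl i))

lemma ae_power (h : IsAlgorithm ℱ p B u₀ obs π) (hobs : IsOnOffModel μ ℱ obs lam)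
    (hu₀ : u₀.Nonneg) (hB : 0 < B) (h' : IsFeasible μ ℱ p lam u₀ obs π') :
    ∀ᵐ ω ∂μ, limsup (timeAvg fun k => slotPower p (π k ω)) atTop ≤ p.Pavg := by
  filter_upwards [h.ae_tendsto_levels_div hobs hu₀ hB h' (Sum.inr ())] with ω hqueue
  exact limsup_timeAvg_le_of_tendsto (fun k => (h.decision k ω).valid.slotPower_mem_Icc) hqueue
    fun k => levels_queues_sub_succ_le p u₀ obs π k ω (Sum.inr ())

lemma sumThroughput_sub_le_timeAvg_admitted (h : IsAlgorithm ℱ p B u₀ obs π)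
    (hobs : IsOnOffModel μ ℱ obs lam) (hu₀ : u₀.Nonneg) (hB : 0 < B)
    (h' : IsFeasible μ ℱ p lam u₀ obs π') {K : ℕ} (hK : K ≠ 0) :
    sumThroughput μ p u₀ obs π' - C1 p N / (p.L * B) - lyapunov u₀ / (p.L * B) / K ≤
      timeAvg (fun k => ∫ ω, admitted (π k ω) ∂μ) K := by
  have hL := p.L_pos
  have hKpos : (0 : ℝ) < K := Nat.cast_pos.2 (Nat.pos_of_ne_zero hK)
  have hlyap : 0 ≤ ∫ ω, lyapunov (queues p u₀ obs π K ω) ∂μ :=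
    integral_nonneg fun ω => lyapunov_nonneg _
  have hscale : (sumThroughput μ p u₀ obs π' - C1 p N / (p.L * B)
      - lyapunov u₀ / (p.L * B) / K) * K =
        (K * (B * p.L * sumThroughput μ p u₀ obs π') - K * C1 p N - lyapunov u₀)
          / (B * p.L) := by
    field_simp
  rw [timeAvg, le_div_iff₀ hKpos, hscale, div_le_iff₀ (mul_pos hB hL)]
  linarith [h.lyapunov_add_le hobs hu₀ hB h' K]

lemma sumThroughput_sub_le (h : IsAlgorithm ℱ p B u₀ obs π) (hobs : IsOnOffModel μ ℱ obs lam)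
    (hu₀ : u₀.Nonneg) (hB : 0 < B) (h' : IsFeasible μ ℱ p lam u₀ obs π') :
    sumThroughput μ p u₀ obs π' - C1 p N / (p.L * B) ≤ sumThroughput μ p u₀ obs π := by
  have hπ := h.isSlotwiseFeasible hobs.measurable
  let M : ℝ := (∑ i, max (u₀.Q i) (B + p.L)) / p.L
  refine (le_liminf_timeAvg_iff (hπ.sum_integral_packets_mem_Icc hu₀)).2 fun ε hε => ?_
  filter_upwards [eventually_neg_le_const_div (-M - lyapunov u₀ / (p.L * B)) hε,
    eventually_ne_atTop 0] with K hconst hK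
  have hM : ∫ ω, backlog p (queues p u₀ obs π K ω) ∂μ ≤ M := by
    have hle := integral_mono (hπ.integrable_backlog (μ := μ) hu₀ K) (integrable_const M)
      fun ω => h.backlog_queues_le hu₀ K ω
    rwa [integral_const, probReal_univ, one_smul] at hle
  have hbacklog : -M / K ≤ (backlog p u₀ - ∫ ω, backlog p (queues p u₀ obs π K ω) ∂μ) / K := by
    gcongr
    linarith [backlog_nonneg p hu₀]
  rw [hπ.timeAvg_sum_integral_packets hu₀]
  rw [sub_div] at hconst
  linarith [h.sumThroughput_sub_le_timeAvg_admitted hobs hu₀ hB h' hK]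

end IsAlgorithm

end Performance

end RTNRT

theorem mainTheorem1 {R N Ω : Type*} [Fintype R] [Fintype N] [Nonempty N]
    [mΩ : MeasurableSpace Ω] (μ : Measure Ω) [IsProbabilityMeasure μ] (ℱ : Filtration ℕ mΩ)
    (p : RTNRT.Params R) (lam : R → ℝ) (obs : ℕ → Ω → RTNRT.Slot R N)
    (hobs : RTNRT.IsOnOffModel μ ℱ obs lam)
    (u₀ : RTNRT.State R N) (hu₀ : u₀.Nonneg)
    (hfeas : ∃ π, RTNRT.IsFeasible μ ℱ p lam u₀ obs π)
    (B : ℝ) (hB : 0 < B) :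
    (∃ π, RTNRT.IsAlgorithm ℱ p B u₀ obs π) ∧
    ∀ π, RTNRT.IsAlgorithm ℱ p B u₀ obs π →
      RTNRT.IsFeasible μ ℱ p lam u₀ obs π ∧
      (∀ i : R, ∀ᵐ ω ∂μ, lam i * p.q i ≤
        liminf (RTNRT.timeAvg fun k => RTNRT.packets p u₀ obs π (Sum.inl i) k ω) atTop) ∧
      (∀ᵐ ω ∂μ, limsup (RTNRT.timeAvg fun k => RTNRT.slotPower p (π k ω)) atTop ≤ p.Pavg) ∧
      RTNRT.optThroughput μ ℱ p lam u₀ obs - RTNRT.C1 p N / (p.L * B) ≤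
        RTNRT.sumThroughput μ p u₀ obs π := by
  refine ⟨RTNRT.exists_isAlgorithm p B hu₀ hobs.measurable, fun π h => ?_⟩
  obtain ⟨π₀, h₀⟩ := hfeas
  refine ⟨h.isFeasible hobs hu₀ hB h₀, h.ae_delivery hobs hu₀ hB h₀, h.ae_power hobs hu₀ hB h₀, ?_⟩
  rw [sub_le_iff_le_add]
  refine csSup_le ⟨_, π₀, h₀, rfl⟩ ?_
  rintro _ ⟨π', h', rfl⟩
  exact sub_le_iff_le_add.1 (h.sumThroughput_sub_le hobs hu₀ hB h')
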